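/- Let $X$ and $Y$ be simply connected, complete, homogeneous Riemannian manifolds (finite-dimensional, smooth, without boundary, with their Riemannian distances; homogeneous means that the isometry group acts transitively). Suppose that $X$ is quasi-isometric to $Y$, i.e. there are a map $\psi:X\to Y$ and constants $K\ge 1$, $c\ge 0$ such that $K^{-1}d(x,x')-c\le d(\psi(x),\psi(x'))\le K\,d(x,x')+c$ for all $x,x'\in X$ and every point of $Y$ is within distance $c$ of $\psi(X)$. For a metric space $Z$ and a loop $\gamma:S^1\to Z$, where $S^1\subset D^2\subset\mathbb{C}$ are the unit circle and the closed unit disk with the Euclidean metric, let $$\operatorname{Span}(\gamma)=\inf\{\operatorname{Lip}(f)\mid f:D^2\to Z,\ f|_{S^1}=\gamma\}\in[0,\infty],$$ where $\operatorname{Lip}(f)\in[0,\infty]$ is the optimal Lipschitz constant of $f$ (with value $\infty$ if $f$ is not Lipschitz). Call $Z$ Lipschitz 1-connected if there is a constant $C<\infty$ such that $\operatorname{Span}(\gamma)\le C\operatorname{Lip}(\gamma)$ for all Lipschitz loops $\gamma:S^1\to Z$. If $Y$ is Lipschitz 1-connected, then so is $X$. -/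

import Mathlib

open scoped NNReal ENNReal Manifold ContDiff Bundle

/-- A metric space is homogeneous if its group of isometries acts transitively. In particular this
holds as soon as some (Lie) group acts transitively by isometries; see
`IsHomogeneousMetricSpace.of_action`. -/
def IsHomogeneousMetricSpace (X : Type*) [MetricSpace X] : Prop :=
  ∀ x y : X, ∃ e : X ≃ᵢ X, e x = y

theorem IsHomogeneousMetricSpace.of_action (G X : Type*) [Group G] [MetricSpace X] [MulAction G X]
    [IsIsometricSMul G X] [MulAction.IsPretransitive G X] : IsHomogeneousMetricSpace X := by
  intro x y
  obtain ⟨g, hg⟩ := MulAction.exists_smul_eq G x y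
  exact ⟨IsometryEquiv.constSMul g, hg⟩

/-- `f` is a quasi-isometry: a coarsely bilipschitz map with coarsely dense image. -/
def IsQuasiIsometry {X Y : Type*} [MetricSpace X] [MetricSpace Y] (f : X → Y) : Prop :=
  ∃ K C : ℝ, 1 ≤ K ∧ 0 ≤ C ∧
    (∀ x x' : X, K⁻¹ * dist x x' - C ≤ dist (f x) (f x') ∧
      dist (f x) (f x') ≤ K * dist x x' + C) ∧
    ∀ y : Y, ∃ x : X, dist (f x) y ≤ C

/-- `X` is quasi-isometric to `Y`. -/
def QuasiIsometric (X Y : Type*) [MetricSpace X] [MetricSpace Y] : Prop :=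
  ∃ f : X → Y, IsQuasiIsometry f

/-- The unit circle, with the metric induced from `ℂ`. -/
abbrev UnitCircle : Type := Metric.sphere (0 : ℂ) 1

/-- The closed unit disk, with the Euclidean metric. -/
abbrev UnitDisk : Type := Metric.closedBall (0 : ℂ) 1

/-- The inclusion of the unit circle in the closed unit disk. -/
def circleToDisk : UnitCircle → UnitDisk :=
  Set.inclusion Metric.sphere_subset_closedBall

/-- The optimal Lipschitz constant of `f`; it is `∞` if `f` is not Lipschitz. -/
noncomputable def lipConst {A B : Type*} [MetricSpace A] [MetricSpace B] (f : A → B) : ℝ≥0∞ :=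
  ⨅ (K : ℝ≥0) (_ : LipschitzWith K f), (K : ℝ≥0∞)

/-- The filling span of a loop: the infimum of the Lipschitz constants of the maps from the disk
that restrict to the loop on the circle; it is `∞` if there is no Lipschitz filling. -/
noncomputable def fillingSpan {X : Type*} [MetricSpace X] (γ : UnitCircle → X) : ℝ≥0∞ :=
  ⨅ (f : UnitDisk → X) (_ : f ∘ circleToDisk = γ), lipConst f

/-- `X` is Lipschitz 1-connected: the filling span of every Lipschitz loop is at most a fixed
finite multiple of its Lipschitz constant. -/
def LipschitzOneConnected (X : Type*) [MetricSpace X] : Prop :=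
  ∃ C : ℝ≥0, ∀ γ : UnitCircle → X, (∃ K : ℝ≥0, LipschitzWith K γ) →
    fillingSpan γ ≤ C * lipConst γ

open Set Metric Topology Filter

/-- Two points at distance less than `ℓ` are joined by an `ℓ`-Lipschitz path parametrized by the
unit interval (and extended to the real line). -/
def HasLipschitzPaths (X : Type*) [MetricSpace X] : Prop :=
  ∀ (x y : X) (ℓ : ℝ≥0), dist x y < ℓ → ∃ p : ℝ → X, LipschitzWith ℓ p ∧ p 0 = x ∧ p 1 = y

section Riemannian

open MeasureTheory Manifold

/-- Reparametrization of a path by a continuous monotone majorant of its arc length. -/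
theorem exists_lipschitzWith_of_arclength {X : Type*} [MetricSpace X] {γ : ℝ → X} {s : ℝ → ℝ}
    (hs : MonotoneOn s (Icc 0 1)) (hc : ContinuousOn s (Icc 0 1)) (hs0 : s 0 = 0)
    (hd : ∀ a ∈ Icc (0 : ℝ) 1, ∀ b ∈ Icc (0 : ℝ) 1, a ≤ b → dist (γ a) (γ b) ≤ s b - s a)
    {ℓ : ℝ≥0} (hℓ : s 1 ≤ ℓ) :
    ∃ p : ℝ → X, LipschitzWith ℓ p ∧ p 0 = γ 0 ∧ p 1 = γ 1 := by
  have h0 : (0 : ℝ) ∈ Icc (0 : ℝ) 1 := by simp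
  have h1 : (1 : ℝ) ∈ Icc (0 : ℝ) 1 := by simp
  have hs1 : 0 ≤ s 1 := hs0 ▸ hs h0 h1 zero_le_one
  have hex : ∀ u : ℝ, ∃ t ∈ Icc (0 : ℝ) 1, s t = s 1 * projIcc (0 : ℝ) 1 zero_le_one u := by
    intro u
    have hu := (projIcc (0 : ℝ) 1 zero_le_one u).2
    apply intermediate_value_Icc zero_le_one hc
    rw [hs0]
    exact ⟨mul_nonneg hs1 hu.1, mul_le_of_le_one_right hs1 hu.2⟩
  choose τ hτ hsτ using hex
  have key : ∀ a ∈ Icc (0 : ℝ) 1, ∀ b ∈ Icc (0 : ℝ) 1, dist (γ a) (γ b) ≤ |s a - s b| := by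
    intro a ha b hb
    rcases le_total a b with h | h
    · rw [abs_sub_comm]; exact (hd a ha b hb h).trans (le_abs_self _)
    · rw [dist_comm]; exact (hd b hb a ha h).trans (le_abs_self _)
  have key0 : ∀ a ∈ Icc (0 : ℝ) 1, ∀ b ∈ Icc (0 : ℝ) 1, s a = s b → γ a = γ b := by
    intro a ha b hb h
    have := key a ha b hb
    rw [h, sub_self, abs_zero] at this
    exact dist_le_zero.1 this
  refine ⟨fun u ↦ γ (τ u), LipschitzWith.of_dist_le_mul fun u v ↦ ?_, ?_, ?_⟩
  · refine (key _ (hτ u) _ (hτ v)).trans ?_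
    rw [hsτ, hsτ, ← mul_sub, abs_mul, abs_of_nonneg hs1]
    refine mul_le_mul hℓ ?_ (abs_nonneg _) ℓ.2
    have := (LipschitzWith.projIcc (zero_le_one : (0 : ℝ) ≤ 1)).dist_le_mul u v
    simpa [Subtype.dist_eq, Real.dist_eq] using this
  · exact key0 _ (hτ _) _ h0 (by rw [hsτ, hs0]; simp)
  · exact key0 _ (hτ _) _ h1 (by rw [hsτ]; simp)

variable {E : Type*} [NormedAddCommGroup E] [NormedSpace ℝ E]
  {H : Type*} [TopologicalSpace H] {I : ModelWithCorners ℝ E H}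
  {M : Type*} [MetricSpace M] [ChartedSpace H M]
  [Bundle.RiemannianBundle (fun x : M ↦ TangentSpace I x)]

theorem edist_le_pathELength [IsRiemannianManifold I M] {γ : ℝ → M} {a b : ℝ}
    (hγ : CMDiff[Icc a b] 1 γ) (hab : a ≤ b) :
    edist (γ a) (γ b) ≤ pathELength I γ a b := by
  rw [IsRiemannianManifold.out (I := I) (γ a) (γ b)]
  exact riemannianEDist_le_pathELength hγ rfl rfl hab

theorem continuousOn_toReal_pathELength {γ : ℝ → M} (h : pathELength I γ 0 1 ≠ ⊤) :
    ContinuousOn (fun t ↦ (pathELength I γ 0 t).toReal) (Icc 0 1) := by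
  have hfin : ∀ a ∈ Icc (0 : ℝ) 1, ∀ b ∈ Icc (0 : ℝ) 1, pathELength I γ a b ≠ ⊤ :=
    fun a ha b hb ↦ ne_top_of_le_ne_top h (pathELength_mono ha.1 hb.2)
  have h0 : (0 : ℝ) ∈ Icc (0 : ℝ) 1 := by simp
  rw [Metric.continuousOn_iff]
  intro t ht ε hε
  rw [pathELength_eq_lintegral_mfderiv_Icc] at h
  obtain ⟨δ, hδ, H⟩ := exists_pos_setLIntegral_lt_of_measure_lt h
    (ENNReal.ofReal_pos.2 hε).ne'
  have main : ∀ a ∈ Icc (0 : ℝ) 1, ∀ b ∈ Icc (0 : ℝ) 1, a ≤ b → ENNReal.ofReal (b - a) < δ →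
      (pathELength I γ 0 b).toReal - (pathELength I γ 0 a).toReal ∈ Ico 0 ε := by
    intro a ha b hb hab hlt
    have h1 : volume.restrict (Icc (0 : ℝ) 1) (Icc a b) < δ := by
      refine (Measure.restrict_apply_le _ _).trans_lt ?_
      simpa using hlt
    have h2 := H _ h1
    rw [Measure.restrict_restrict measurableSet_Icc,
      inter_eq_left.2 (Icc_subset_Icc ha.1 hb.2), ← pathELength_eq_lintegral_mfderiv_Icc] at h2
    have h3 := pathELength_add (I := I) (γ := γ) ha.1 hab
    rw [← h3, ENNReal.toReal_add (hfin _ h0 _ ha) (hfin _ ha _ hb), add_sub_cancel_left]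
    exact ⟨ENNReal.toReal_nonneg, (ENNReal.lt_ofReal_iff_toReal_lt (hfin _ ha _ hb)).1 h2⟩
  obtain ⟨r, hr, hrδ⟩ : ∃ r : ℝ, 0 < r ∧ ENNReal.ofReal r ≤ δ := by
    rcases eq_or_ne δ ⊤ with rfl | hne
    · exact ⟨1, one_pos, le_top⟩
    · exact ⟨δ.toReal, ENNReal.toReal_pos hδ.ne' hne, ENNReal.ofReal_toReal_le⟩
  refine ⟨r, hr, fun u hu hut ↦ ?_⟩
  rw [Real.dist_eq] at hut ⊢
  have hb : ENNReal.ofReal |u - t| < δ := lt_of_lt_of_le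
    ((ENNReal.ofReal_lt_ofReal_iff hr).2 hut) hrδ
  rcases le_total u t with hle | hle
  · rw [abs_sub_comm, abs_of_nonneg (sub_nonneg.2 hle)] at hb
    have := main u hu t ht hle hb
    rw [abs_sub_comm, abs_of_nonneg this.1]; exact this.2
  · rw [abs_of_nonneg (sub_nonneg.2 hle)] at hb
    have := main t ht u hu hle hb
    rw [abs_of_nonneg this.1]; exact this.2

variable (I M) in
theorem IsRiemannianManifold.hasLipschitzPaths [IsRiemannianManifold I M] : HasLipschitzPaths M := by
  intro x y ℓ h
  have h' : riemannianEDist I x y < ℓ := by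
    rw [← IsRiemannianManifold.out (I := I) x y, edist_dist]
    rw [ENNReal.ofReal_lt_iff_lt_toReal dist_nonneg ENNReal.coe_ne_top]
    simpa using h
  obtain ⟨γ, rfl, rfl, hγ, hlen⟩ := exists_lt_of_riemannianEDist_lt h'
  have hfin : ∀ a ∈ Icc (0 : ℝ) 1, ∀ b ∈ Icc (0 : ℝ) 1, pathELength I γ a b ≠ ⊤ :=
    fun a ha b hb ↦ ne_top_of_le_ne_top hlen.ne_top (pathELength_mono ha.1 hb.2)
  have h0 : (0 : ℝ) ∈ Icc (0 : ℝ) 1 := by simp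
  refine exists_lipschitzWith_of_arclength (s := fun t ↦ (pathELength I γ 0 t).toReal)
    ?_ (continuousOn_toReal_pathELength hlen.ne_top) (by simp) ?_ ?_
  · intro a ha b hb hab
    exact ENNReal.toReal_mono (hfin _ h0 _ hb) (pathELength_mono le_rfl hab)
  · intro a ha b hb hab
    have h1 := edist_le_pathELength (I := I) (hγ.mono (Icc_subset_Icc ha.1 hb.2)) hab
    have h2 := pathELength_add (I := I) (γ := γ) ha.1 hab
    rw [dist_edist]
    rw [← h2, ENNReal.toReal_add (hfin _ h0 _ ha) (hfin _ ha _ hb), add_sub_cancel_left]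
    exact ENNReal.toReal_mono (hfin _ ha _ hb) h1
  · simpa using ENNReal.toReal_mono ENNReal.coe_ne_top hlen.le

end Riemannian

section Chart

open MeasureTheory Manifold

variable {E : Type*} [NormedAddCommGroup E] [NormedSpace ℝ E]
  {H : Type*} [TopologicalSpace H] (I : ModelWithCorners ℝ E H)
  {M : Type*} [MetricSpace M] [ChartedSpace H M]
  [Bundle.RiemannianBundle (fun x : M ↦ TangentSpace I x)] [IsRiemannianManifold I M]
  [IsManifold I 1 M] [IsContinuousRiemannianBundle E (fun x : M ↦ TangentSpace I x)]

attribute [local instance] normedAddCommGroupTangentSpaceVectorSpace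
attribute [local instance] normedSpaceTangentSpaceVectorSpace

theorem exists_lipschitzOnWith_extChartAt_symm [I.Boundaryless] (x : M) :
    ∃ C : ℝ≥0, ∃ r > 0, ball (extChartAt I x x) r ⊆ (extChartAt I x).target ∧
      LipschitzOnWith C (extChartAt I x).symm (ball (extChartAt I x x) r) := by
  rcases eventually_enorm_mfderivWithin_symm_extChartAt_lt I x with ⟨C, C_pos, hC⟩
  have hC' : ∀ᶠ y in 𝓝[range I] (extChartAt I x x), ∀ v : TangentSpace 𝓘(ℝ, E) y,
      ‖mfderiv[range I] (extChartAt I x).symm y v‖ₑ ≤ C * ‖v‖ₑ := by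
    filter_upwards [hC] with y hy v
    exact (ContinuousLinearMap.le_opENorm _ v).trans (mul_le_mul_left hy.le _)
  obtain ⟨r, r_pos, hr⟩ : ∃ r > 0,
      ball (extChartAt I x x) r ∩ range I ⊆ (extChartAt I x).target ∩
        {y | ∀ v : TangentSpace 𝓘(ℝ, E) y,
          ‖mfderiv[range I] (extChartAt I x).symm y v‖ₑ ≤ C * ‖v‖ₑ} :=
    mem_nhdsWithin_iff.1 (inter_mem (extChartAt_target_mem_nhdsWithin x) hC')
  rw [I.range_eq_univ, inter_univ] at hr
  refine ⟨C, r, r_pos, fun y hy ↦ (hr hy).1, fun y hy z hz ↦ ?_⟩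
  let η := ContinuousAffineMap.lineMap (R := ℝ) y z
  set γ := (extChartAt I x).symm ∘ η
  have hη : Icc 0 1 ⊆ ⇑η ⁻¹' ((extChartAt I x).target ∩
        {y | ∀ v : TangentSpace 𝓘(ℝ, E) y,
          ‖mfderiv[range I] (extChartAt I x).symm y v‖ₑ ≤ C * ‖v‖ₑ}) := by
    simp only [← image_subset_iff, ContinuousAffineMap.coe_lineMap_eq,
     ← segment_eq_image_lineMap, η]
    rw [I.range_eq_univ]
    exact ((convex_ball _ _).segment_subset hy hz).trans hr
  simp only [preimage_inter, subset_inter_iff] at hη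
  have η_smooth : CMDiff[Icc 0 1] 1 η := by
    apply ContMDiff.contMDiffOn
    rw [contMDiff_iff_contDiff]
    exact ContinuousAffineMap.contDiff _
  have : edist ((extChartAt I x).symm y) ((extChartAt I x).symm z) ≤ pathELength I γ 0 1 := by
    rw [IsRiemannianManifold.out (I := I)]
    apply riemannianEDist_le_pathELength _ _ _ zero_le_one
    · exact (contMDiffOn_extChartAt_symm x).comp η_smooth hη.1
    · simp [γ, η, ContinuousAffineMap.coe_lineMap_eq]
    · simp [γ, η, ContinuousAffineMap.coe_lineMap_eq]
  apply this.trans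
  rw [← lintegral_fderiv_lineMap_eq_edist, pathELength_eq_lintegral_mfderivWithin_Icc,
    ← lintegral_const_mul' _ _ ENNReal.coe_ne_top]
  apply setLIntegral_mono' measurableSet_Icc (fun t ht ↦ ?_)
  have : mfderiv[Icc 0 1] γ t =
      (mfderiv[range I] (extChartAt I x).symm (η t)) ∘L (mfderiv[Icc 0 1] η t) := by
    apply mfderivWithin_comp
    · exact mdifferentiableWithinAt_extChartAt_symm (hη.1 ht)
    · exact η_smooth.mdifferentiableOn one_ne_zero t ht
    · exact hη.1.trans (preimage_mono (extChartAt_target_subset_range x))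
    · rw [uniqueMDiffWithinAt_iff_uniqueDiffWithinAt]
      exact uniqueDiffOn_Icc zero_lt_one t ht
  have : mfderiv[Icc 0 1] γ t 1 =
      (mfderiv[range I] (extChartAt I x).symm (η t)) (mfderiv[Icc 0 1] η t 1) := DFunLike.congr_fun this 1
  rw [this]
  apply (hη.2 ht _).trans
  gcongr
  simp only [mfderivWithin_eq_fderivWithin]
  exact le_of_eq rfl

theorem exists_lipschitzOnWith_extChartAt (x : M) :
    ∃ C : ℝ≥0, ∃ r > 0, ball x r ⊆ (extChartAt I x).source ∧
      LipschitzOnWith C (extChartAt I x) (ball x r) := by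
  rcases eventually_enorm_mfderiv_extChartAt_lt I x with ⟨C, C_pos, hC⟩
  obtain ⟨r, r_pos, hr⟩ := Metric.mem_nhds_iff.1
    (Filter.inter_mem (extChartAt_source_mem_nhds (I := I) x) hC)
  refine ⟨C, r / 3, by positivity, fun y hy ↦ (hr (ball_subset_ball (by linarith) hy)).1,
    fun y hy z hz ↦ ?_⟩
  have hyz : edist y z < ENNReal.ofReal (2 * r / 3) := by
    rw [edist_dist]
    apply (ENNReal.ofReal_lt_ofReal_iff (by positivity)).2
    have := dist_triangle_right y z x
    rw [mem_ball] at hy hz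
    linarith
  suffices H : ∀ ℓ : ℝ≥0∞, edist y z < ℓ → ℓ ≤ ENNReal.ofReal (2 * r / 3) →
      edist (extChartAt I x y) (extChartAt I x z) ≤ C * ℓ by
    have h1 : Tendsto (fun ℓ : ℝ≥0∞ ↦ (C : ℝ≥0∞) * ℓ) (𝓝[>] (edist y z))
        (𝓝 (C * edist y z)) :=
      ((ENNReal.continuous_const_mul ENNReal.coe_ne_top).tendsto _).mono_left nhdsWithin_le_nhds
    have : (𝓝[>] (edist y z)).NeBot := nhdsGT_neBot_of_exists_gt ⟨_, hyz⟩
    refine ge_of_tendsto h1 ?_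
    filter_upwards [Ioo_mem_nhdsGT hyz] with ℓ hℓ using H ℓ hℓ.1 hℓ.2.le
  intro ℓ hℓ hℓr
  have hR : riemannianEDist I y z < ℓ := by rwa [← IsRiemannianManifold.out (I := I) y z]
  rcases exists_lt_locally_constant_of_riemannianEDist_lt hR zero_lt_one
    with ⟨γ, hγx, hγy, γ_smooth, hγ, -⟩
  have hmem : ∀ t ∈ Icc (0 : ℝ) 1, γ t ∈ ball x r := by
    intro t ht
    have h1 : edist (γ 0) (γ t) < ENNReal.ofReal (2 * r / 3) :=
      (((edist_le_pathELength (I := I) γ_smooth.contMDiffOn ht.1).trans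
        (pathELength_mono le_rfl ht.2)).trans_lt hγ).trans_le hℓr
    rw [edist_dist, ENNReal.ofReal_lt_ofReal_iff (by positivity), hγx] at h1
    have := dist_triangle_left (γ t) x y
    rw [mem_ball] at hy ⊢
    linarith
  have uc' : ∀ t ∈ Icc (0 : ℝ) 1, γ t ∈ (chartAt H x).source := fun t ht ↦ by
    simpa [extChartAt_source I x] using (hr (hmem t ht)).1
  let γ' := extChartAt I x ∘ γ
  have hC' : CMDiff[Icc 0 1] 1 γ' :=
    contMDiffOn_extChartAt.comp (I' := I) (t := (chartAt H x).source)
      γ_smooth.contMDiffOn (fun t' ht' ↦ uc' _ ht')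
  calc edist (extChartAt I x y) (extChartAt I x z) = ‖γ' 1 - γ' 0‖ₑ := by
        rw [edist_comm, edist_eq_enorm_sub]
        simp [γ', hγx, hγy]
    _ ≤ ∫⁻ t' in Icc 0 1, ‖derivWithin γ' (Icc 0 1) t'‖ₑ := by
      apply enorm_sub_le_lintegral_derivWithin_Icc_of_contDiffOn_Icc _ zero_le_one
      rwa [← contMDiffOn_iff_contDiffOn]
    _ = ∫⁻ t' in Icc 0 1, ‖mfderiv[Icc 0 1] γ' t' 1‖ₑ := by
      simp_rw [← fderivWithin_derivWithin, mfderivWithin_eq_fderivWithin]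
      rfl
    _ ≤ ∫⁻ t' in Icc 0 1, C * ‖mfderiv[Icc 0 1] γ t' 1‖ₑ := by
      apply setLIntegral_mono' measurableSet_Icc (fun t' ht' ↦ ?_)
      have : mfderiv[Icc 0 1] γ' t' =
          (mfderiv% (extChartAt I x) (γ t')) ∘L (mfderiv[Icc 0 1] γ t') := by
        apply mfderiv_comp_mfderivWithin
        · exact mdifferentiableAt_extChartAt (uc' _ ht')
        · exact (γ_smooth.mdifferentiable one_ne_zero).mdifferentiableOn _ ht'
        · rw [uniqueMDiffWithinAt_iff_uniqueDiffWithinAt]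
          exact uniqueDiffOn_Icc zero_lt_one _ ht'
      have : mfderiv[Icc 0 1] γ' t' 1 =
          (mfderiv% (extChartAt I x) (γ t')) (mfderiv[Icc 0 1] γ t' 1) :=
        DFunLike.congr_fun this 1
      rw [this]
      apply (ContinuousLinearMap.le_opENorm _ _).trans
      gcongr
      exact (hr (hmem _ ht')).2.le
    _ = C * pathELength I γ 0 1 := by
      rw [lintegral_const_mul' _ _ ENNReal.coe_ne_top,
          pathELength_eq_lintegral_mfderivWithin_Icc]
    _ ≤ C * ℓ := by gcongr

end Chart

section Squares

variable {X : Type*} [MetricSpace X]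

/-- The boundary of the square `[0, a] × [0, a]`. -/
def squareBoundary (a : ℝ) : Set (ℝ × ℝ) :=
  {p | p.1 ∈ Icc 0 a ∧ p.2 ∈ Icc 0 a ∧ ((p.2 = 0 ∨ p.2 = a) ∨ (p.1 = 0 ∨ p.1 = a))}

variable (X) in
/-- Every `L`-Lipschitz map on the boundary of the unit square extends to a `C`-Lipschitz map. -/
def SquareFills (L C : ℝ≥0) : Prop :=
  ∀ g : ℝ × ℝ → X, LipschitzOnWith L g (squareBoundary 1) →
    ∃ f : ℝ × ℝ → X, LipschitzWith C f ∧ EqOn f g (squareBoundary 1)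

theorem SquareFills.mono {L L' C C' : ℝ≥0} (h : SquareFills X L C) (hL : L' ≤ L) (hC : C ≤ C') :
    SquareFills X L' C' := fun g hg ↦ by
  obtain ⟨f, hf, hfg⟩ := h g (hg.weaken hL)
  exact ⟨f, hf.weaken hC, hfg⟩

theorem lipschitzWith_of_lipschitzOnWith_Icc_int {K : ℝ≥0} {f : ℝ → X}
    (h : ∀ k : ℤ, LipschitzOnWith K f (Icc k (k + 1))) : LipschitzWith K f := by
  have main : ∀ n : ℕ, ∀ x y : ℝ, x ≤ y → y ≤ ⌊x⌋ + 1 + n → dist (f x) (f y) ≤ K * (y - x) := by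
    intro n
    induction n with
    | zero =>
      intro x y hxy hy
      have hx := Int.floor_le x
      have hx' := (Int.lt_floor_add_one x).le
      have := (h ⌊x⌋).dist_le_mul x ⟨hx, hx'⟩ y ⟨hx.trans hxy, by simpa using hy⟩
      rwa [dist_comm x y, Real.dist_eq, abs_of_nonneg (sub_nonneg.2 hxy)] at this
    | succ n ih =>
      intro x y hxy hy
      rcases le_total y (⌊x⌋ + 1 + n) with hle | hle
      · exact ih x y hxy hle
      · have hx' := (Int.lt_floor_add_one x).le
        have hxz : x ≤ ⌊x⌋ + 1 + n := hx'.trans (by linarith [n.cast_nonneg (α := ℝ)])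
        have h1 := ih x (⌊x⌋ + 1 + n) hxz le_rfl
        have h2 := (h (⌊x⌋ + 1 + n)).dist_le_mul (⌊x⌋ + 1 + n) (by simp) y
          ⟨by push_cast; exact hle, by push_cast at hy ⊢; linarith⟩
        rw [dist_comm (_ : ℝ) y, Real.dist_eq, abs_of_nonneg (sub_nonneg.2 hle)] at h2
        have h3 := dist_triangle (f x) (f (⌊x⌋ + 1 + n)) (f y)
        linarith
  refine LipschitzWith.of_dist_le_mul fun x y ↦ ?_
  wlog hxy : x ≤ y generalizing x y
  · rw [dist_comm, dist_comm x]; exact this y x (le_of_not_ge hxy)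
  rw [dist_comm x y, Real.dist_eq, abs_of_nonneg (sub_nonneg.2 hxy)]
  refine main ⌈y - x⌉₊ x y hxy ?_
  linarith [Nat.le_ceil (y - x), (Int.lt_floor_add_one x).le]

theorem lipschitzWith_prod_of_lipschitzWith {K : ℝ≥0} {F : ℝ × ℝ → X}
    (h₁ : ∀ y, LipschitzWith K fun x ↦ F (x, y)) (h₂ : ∀ x, LipschitzWith K fun y ↦ F (x, y)) :
    LipschitzWith (2 * K) F := by
  refine LipschitzWith.of_dist_le_mul fun p q ↦ ?_
  have a1 := (h₁ p.2).dist_le_mul p.1 q.1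
  have a2 := (h₂ q.1).dist_le_mul p.2 q.2
  have a3 := dist_triangle (F p) (F (q.1, p.2)) (F q)
  have a4 : dist p.1 q.1 ≤ dist p q := by rw [Prod.dist_eq]; exact le_max_left _ _
  have a5 : dist p.2 q.2 ≤ dist p q := by rw [Prod.dist_eq]; exact le_max_right _ _
  have a6 := mul_le_mul_of_nonneg_left a4 K.2
  have a7 := mul_le_mul_of_nonneg_left a5 K.2
  push_cast
  simp only [NNReal.val_eq_coe] at a6 a7
  calc dist (F p) (F q) ≤ _ := a3
    _ ≤ 2 * K * dist p q := by linarith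

theorem exists_lipschitzOnWith_squareBoundary {a : ℝ} (ha : 0 < a) {K : ℝ≥0}
    {bot top left right : ℝ → X} (hbot : LipschitzOnWith K bot (Icc 0 a))
    (htop : LipschitzOnWith K top (Icc 0 a)) (hleft : LipschitzOnWith K left (Icc 0 a))
    (hright : LipschitzOnWith K right (Icc 0 a)) (hbl : bot 0 = left 0) (hbr : bot a = right 0)
    (htl : top 0 = left a) (htr : top a = right a) :
    ∃ b : ℝ × ℝ → X, LipschitzOnWith (3 * K) b (squareBoundary a) ∧
      ∀ t, b (t, 0) = bot t ∧ b (t, a) = top t ∧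
        (t ∈ Icc 0 a → b (0, t) = left t ∧ b (a, t) = right t) := by
  classical
  let b : ℝ × ℝ → X := fun p ↦ if p.2 = 0 then bot p.1 else if p.2 = a then top p.1 else
    if p.1 = 0 then left p.2 else right p.2
  have hb : ∀ t, b (t, 0) = bot t ∧ b (t, a) = top t ∧
        (t ∈ Icc 0 a → b (0, t) = left t ∧ b (a, t) = right t) := by
    intro t
    refine ⟨by simp [b], by simp [b, ha.ne'], fun ht ↦ ?_⟩
    by_cases h0 : t = 0
    · subst h0; simp [b, hbl, hbr]
    · by_cases h1 : t = a
      · subst h1; simp [b, ha.ne', htl, htr]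
      · simp [b, h0, h1, ha.ne']
  have hH : ∀ y, (y = 0 ∨ y = a) → ∀ s ∈ Icc 0 a, ∀ t ∈ Icc 0 a,
      dist (b (s, y)) (b (t, y)) ≤ K * dist s t := by
    rintro y (rfl | rfl) s hs t ht
    · rw [(hb s).1, (hb t).1]; exact hbot.dist_le_mul s hs t ht
    · rw [(hb s).2.1, (hb t).2.1]; exact htop.dist_le_mul s hs t ht
  have hV : ∀ x, (x = 0 ∨ x = a) → ∀ s ∈ Icc 0 a, ∀ t ∈ Icc 0 a,
      dist (b (x, s)) (b (x, t)) ≤ K * dist s t := by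
    rintro y (rfl | rfl) s hs t ht
    · rw [((hb s).2.2 hs).1, ((hb t).2.2 ht).1]; exact hleft.dist_le_mul s hs t ht
    · rw [((hb s).2.2 hs).2, ((hb t).2.2 ht).2]; exact hright.dist_le_mul s hs t ht
  have h0 : (0 : ℝ) ∈ Icc 0 a := ⟨le_rfl, ha.le⟩
  have hsmall : ∀ s ∈ Icc 0 a, dist s 0 ≤ a ∧ dist 0 s ≤ a := by
    intro s hs
    rw [dist_comm 0 s, Real.dist_eq, sub_zero, abs_of_nonneg hs.1]
    exact ⟨hs.2, hs.2⟩
  have hopp : ∀ y y' : ℝ, (y = 0 ∨ y = a) → (y' = 0 ∨ y' = a) → y ≠ y' → dist y y' = a := by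
    rintro y y' (rfl | rfl) (rfl | rfl) hne
    · exact absurd rfl hne
    · simp [Real.dist_eq, abs_of_pos ha]
    · simp [abs_of_pos ha]
    · exact absurd rfl hne
  refine ⟨b, LipschitzOnWith.of_dist_le_mul ?_, hb⟩
  rintro ⟨p1, p2⟩ ⟨hp1, hp2, hp⟩ ⟨q1, q2⟩ ⟨hq1, hq2, hq⟩
  simp only at hp1 hp2 hp hq1 hq2 hq
  have d1 : dist p1 q1 ≤ dist (p1, p2) (q1, q2) := le_max_left _ _
  have d2 : dist p2 q2 ≤ dist (p1, p2) (q1, q2) := le_max_right _ _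
  set D := dist (p1, p2) (q1, q2)
  have hD : 0 ≤ D := dist_nonneg
  have hK : (0 : ℝ) ≤ K := K.2
  have hKm : ∀ {u : ℝ}, u ≤ D → K * u ≤ K * D := fun hu ↦ mul_le_mul_of_nonneg_left hu hK
  push_cast
  have hKD : 0 ≤ K * D := mul_nonneg hK hD
  rcases hp with hp | hp <;> rcases hq with hq | hq
  · by_cases heq : p2 = q2
    · subst heq
      linarith [hH p2 hp p1 hp1 q1 hq1, hKm d1]
    · have haD : a ≤ D := (hopp _ _ hp hq heq).symm.le.trans d2
      have e1 := hH p2 hp p1 hp1 0 h0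
      have e2 := hV 0 (Or.inl rfl) p2 hp2 q2 hq2
      have e3 := hH q2 hq 0 h0 q1 hq1
      have := dist_triangle4 (b (p1, p2)) (b (0, p2)) (b (0, q2)) (b (q1, q2))
      linarith [hKm d2, hKm ((hsmall p1 hp1).1.trans haD), hKm ((hsmall q1 hq1).2.trans haD)]
  · have e1 := hH p2 hp p1 hp1 q1 hq1
    have e2 := hV q1 hq p2 hp2 q2 hq2
    have := dist_triangle (b (p1, p2)) (b (q1, p2)) (b (q1, q2))
    linarith [hKm d1, hKm d2]
  · have e1 := hV p1 hp p2 hp2 q2 hq2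
    have e2 := hH q2 hq p1 hp1 q1 hq1
    have := dist_triangle (b (p1, p2)) (b (p1, q2)) (b (q1, q2))
    linarith [hKm d1, hKm d2]
  · by_cases heq : p1 = q1
    · subst heq
      linarith [hV p1 hp p2 hp2 q2 hq2, hKm d2]
    · have haD : a ≤ D := (hopp _ _ hp hq heq).symm.le.trans d1
      have e1 := hV p1 hp p2 hp2 0 h0
      have e2 := hH 0 (Or.inl rfl) p1 hp1 q1 hq1
      have e3 := hV q1 hq 0 h0 q2 hq2
      have := dist_triangle4 (b (p1, p2)) (b (p1, 0)) (b (q1, 0)) (b (q1, q2))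
      linarith [hKm d1, hKm ((hsmall p2 hp2).1.trans haD), hKm ((hsmall q2 hq2).2.trans haD)]

theorem exists_lipschitzWith_of_grid {K C : ℝ≥0} (hfill : SquareFills X (3 * K) C)
    {v : ℤ → ℤ → X} {eh ev : ℤ → ℤ → ℝ → X}
    (heh : ∀ i j, LipschitzOnWith K (eh i j) (Icc 0 1) ∧ eh i j 0 = v i j ∧
      eh i j 1 = v (i + 1) j)
    (hev : ∀ i j, LipschitzOnWith K (ev i j) (Icc 0 1) ∧ ev i j 0 = v i j ∧
      ev i j 1 = v i (j + 1)) :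
    ∃ F : ℝ × ℝ → X, LipschitzWith (2 * C) F ∧ ∀ i j : ℤ, ∀ t ∈ Icc (0 : ℝ) 1,
      F (i + t, j) = eh i j t ∧ F (i, j + t) = ev i j t := by
  have hcell : ∀ i j : ℤ, ∃ f : ℝ × ℝ → X, LipschitzWith C f ∧ ∀ t ∈ Icc (0 : ℝ) 1,
      f (t, 0) = eh i j t ∧ f (t, 1) = eh i (j + 1) t ∧ f (0, t) = ev i j t ∧
        f (1, t) = ev (i + 1) j t := by
    intro i j
    obtain ⟨b, hb, hbt⟩ := exists_lipschitzOnWith_squareBoundary one_pos (heh i j).1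
      (heh i (j + 1)).1 (hev i j).1 (hev (i + 1) j).1
      (by rw [(heh i j).2.1, (hev i j).2.1]) (by rw [(heh i j).2.2, (hev (i + 1) j).2.1])
      (by rw [(heh i (j + 1)).2.1, (hev i j).2.2])
      (by rw [(heh i (j + 1)).2.2, (hev (i + 1) j).2.2])
    obtain ⟨f, hf, hfb⟩ := hfill b hb
    refine ⟨f, hf, fun t ht ↦ ?_⟩
    have h0 : (0 : ℝ) ∈ Icc (0 : ℝ) 1 := by simp
    have h1 : (1 : ℝ) ∈ Icc (0 : ℝ) 1 := by simp
    refine ⟨?_, ?_, ?_, ?_⟩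
    · rw [hfb ⟨ht, h0, by simp⟩, (hbt t).1]
    · rw [hfb ⟨ht, h1, by simp⟩, (hbt t).2.1]
    · rw [hfb ⟨h0, ht, by simp⟩, ((hbt t).2.2 ht).1]
    · rw [hfb ⟨h1, ht, by simp⟩, ((hbt t).2.2 ht).2]
  choose f hf hft using hcell
  let F : ℝ × ℝ → X := fun p ↦ f ⌊p.1⌋ ⌊p.2⌋ (Int.fract p.1, Int.fract p.2)
  have hfloor : ∀ (x : ℝ) (i : ℤ), x ∈ Icc (i : ℝ) (i + 1) →
      (⌊x⌋ = i ∧ Int.fract x = x - i) ∨ (⌊x⌋ = i + 1 ∧ Int.fract x = 0 ∧ x - i = 1) := by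
    intro x i hx
    rcases hx.2.lt_or_eq with hlt | heq
    · have : ⌊x⌋ = i := Int.floor_eq_iff.2 ⟨hx.1, hlt⟩
      exact Or.inl ⟨this, by rw [Int.fract, this]⟩
    · have : ⌊x⌋ = i + 1 := Int.floor_eq_iff.2 ⟨by push_cast; exact heq.ge, by push_cast; linarith⟩
      exact Or.inr ⟨this, by rw [Int.fract, this]; push_cast; linarith, by linarith⟩
  have hfr : ∀ x : ℝ, Int.fract x ∈ Icc (0 : ℝ) 1 := fun x ↦
    ⟨Int.fract_nonneg x, (Int.fract_lt_one x).le⟩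
  have hF : ∀ (x y : ℝ) (i j : ℤ), x ∈ Icc (i : ℝ) (i + 1) → y ∈ Icc (j : ℝ) (j + 1) →
      F (x, y) = f i j (x - i, y - j) := by
    intro x y i j hx hy
    have hx' : x - i ∈ Icc (0 : ℝ) 1 := ⟨by linarith [hx.1], by linarith [hx.2]⟩
    have e1 : F (x, y) = f i ⌊y⌋ (x - i, Int.fract y) := by
      simp only [F]
      rcases hfloor x i hx with ⟨h1, h2⟩ | ⟨h1, h2, h3⟩
      · rw [h1, h2]
      · rw [h1, h2, h3, (hft _ _ _ (hfr y)).2.2.1, (hft _ _ _ (hfr y)).2.2.2]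
    rw [e1]
    rcases hfloor y j hy with ⟨h1, h2⟩ | ⟨h1, h2, h3⟩
    · rw [h1, h2]
    · rw [h1, h2, h3, (hft _ _ _ hx').1, (hft _ _ _ hx').2.1]
  refine ⟨F, lipschitzWith_prod_of_lipschitzWith (fun y ↦ ?_) (fun x ↦ ?_), fun i j t ht ↦ ?_⟩
  · refine lipschitzWith_of_lipschitzOnWith_Icc_int fun k ↦ LipschitzOnWith.of_dist_le_mul ?_
    intro x hx x' hx'
    have hy : y ∈ Icc (⌊y⌋ : ℝ) (⌊y⌋ + 1) := ⟨Int.floor_le y, (Int.lt_floor_add_one y).le⟩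
    rw [hF x y k ⌊y⌋ hx hy, hF x' y k ⌊y⌋ hx' hy]
    refine ((hf k ⌊y⌋).dist_le_mul _ _).trans_eq ?_
    simp [Prod.dist_eq]
  · refine lipschitzWith_of_lipschitzOnWith_Icc_int fun k ↦ LipschitzOnWith.of_dist_le_mul ?_
    intro y hy y' hy'
    have hx : x ∈ Icc (⌊x⌋ : ℝ) (⌊x⌋ + 1) := ⟨Int.floor_le x, (Int.lt_floor_add_one x).le⟩
    rw [hF x y ⌊x⌋ k hx hy, hF x y' ⌊x⌋ k hx hy']
    refine ((hf ⌊x⌋ k).dist_le_mul _ _).trans_eq ?_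
    simp [Prod.dist_eq]
  · rw [hF (i + t) j i j ⟨by linarith [ht.1], by linarith [ht.2]⟩ (by simp),
      hF i (j + t) i j (by simp) ⟨by linarith [ht.1], by linarith [ht.2]⟩]
    simp [(hft i j t ht).1, (hft i j t ht).2.2.1]

/-- The nearest point projection to the square `[0, a] × [0, a]`. -/
noncomputable def clampSquare (a : ℝ) (p : ℝ × ℝ) : ℝ × ℝ := (max 0 (min a p.1), max 0 (min a p.2))

theorem lipschitzWith_clampSquare (a : ℝ) : LipschitzWith 1 (clampSquare a) := by
  have h : LipschitzWith 1 fun x : ℝ ↦ max 0 (min a x) :=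
    (LipschitzWith.id.const_min a).const_max 0
  have := (h.comp LipschitzWith.prod_fst).prodMk (h.comp (LipschitzWith.prod_snd (α := ℝ)))
  simp only [mul_one, max_self] at this
  exact this

theorem clampSquare_of_mem {a : ℝ} {p : ℝ × ℝ} (h₁ : p.1 ∈ Icc 0 a) (h₂ : p.2 ∈ Icc 0 a) :
    clampSquare a p = p := by
  simp [clampSquare, min_eq_right h₁.2, min_eq_right h₂.2, max_eq_right h₁.1, max_eq_right h₂.1]

theorem clampSquare_mem_squareBoundary {a : ℝ} (ha : 0 ≤ a) {p : ℝ × ℝ}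
    (hp : ¬ (p.1 ∈ Ioo 0 a ∧ p.2 ∈ Ioo 0 a)) : clampSquare a p ∈ squareBoundary a := by
  have h : ∀ x : ℝ, max 0 (min a x) ∈ Icc 0 a := fun x ↦ ⟨le_max_left _ _, by simp [ha]⟩
  have h' : ∀ x : ℝ, x ∉ Ioo 0 a → max 0 (min a x) = 0 ∨ max 0 (min a x) = a := by
    intro x hx
    rcases le_or_gt x 0 with h0 | h0
    · left; exact max_eq_left ((min_le_right _ _).trans h0)
    · right
      have : a ≤ x := by by_contra hlt; exact hx ⟨h0, not_le.1 hlt⟩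
      rw [min_eq_left this, max_eq_right ha]
  refine ⟨h _, h _, ?_⟩
  by_cases h1 : p.1 ∈ Ioo 0 a
  · exact Or.inl (h' _ fun h2 ↦ hp ⟨h1, h2⟩)
  · exact Or.inr (h' _ h1)

end Squares

section GridFilling

variable {X : Type*} [MetricSpace X]

theorem clampSquare_intCast (N : ℕ) (i j : ℤ) :
    clampSquare N ((i : ℝ), (j : ℝ)) =
      (((max 0 (min (N : ℤ) i) : ℤ) : ℝ), ((max 0 (min (N : ℤ) j) : ℤ) : ℝ)) := by
  simp [clampSquare]

/-- A map on the boundary of `[0, N] × [0, N]` that is coarsely filled, at the integer points, by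
`w` has a Lipschitz filling, if loops of a bounded size can be filled. -/
theorem exists_filling_of_coarse_filling (hX : HasLipschitzPaths X) {K C : ℝ≥0}
    (hfill : SquareFills X (3 * K) C) (N : ℕ) {g w : ℝ × ℝ → X} {τ : ℝ≥0} {ρ σ : ℝ}
    (hσ0 : 0 ≤ σ) (hτ : τ < K) (hρσ : ρ + σ < K) (hg : LipschitzOnWith τ g (squareBoundary N))
    (hw : ∀ p q, dist p q ≤ 1 → dist (w p) (w q) ≤ ρ)
    (hσ : ∀ i j : ℤ, ((i : ℝ), (j : ℝ)) ∈ squareBoundary N → dist (w (i, j)) (g (i, j)) ≤ σ) :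
    ∃ F : ℝ × ℝ → X, LipschitzWith (2 * C) F ∧ EqOn F g (squareBoundary N) := by
  classical
  let c : ℝ × ℝ → ℝ × ℝ := clampSquare N
  let inner : ℝ × ℝ → Prop := fun p ↦ p.1 ∈ Ioo (0 : ℝ) N ∧ p.2 ∈ Ioo (0 : ℝ) N
  have hc : ∀ p q, dist (c p) (c q) ≤ dist p q := fun p q ↦ by
    simpa using (lipschitzWith_clampSquare (N : ℝ)).dist_le_mul p q
  have hcb : ∀ p, ¬ inner p → c p ∈ squareBoundary N := fun p hp ↦
    clampSquare_mem_squareBoundary N.cast_nonneg hp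
  have hcσ : ∀ i j : ℤ, ¬ inner (i, j) → dist (w (c (i, j))) (g (c (i, j))) ≤ σ := by
    intro i j hij
    have h1 := hcb _ hij
    simp only [c] at h1 ⊢
    rw [clampSquare_intCast] at h1 ⊢
    exact hσ _ _ h1
  let v : ℤ → ℤ → X := fun i j ↦ if inner (i, j) then w (c (i, j)) else g (c (i, j))
  have hv : ∀ i j i' j' : ℤ, dist ((i : ℝ), (j : ℝ)) ((i' : ℝ), (j' : ℝ)) ≤ 1 →
      dist (v i j) (v i' j') < K := by
    intro i j i' j' hd
    have hd' := (hc _ _).trans hd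
    have hww := hw _ _ hd'
    simp only [v]
    split_ifs with h h' h'
    · linarith
    · have := dist_triangle (w (c (i, j))) (w (c (i', j'))) (g (c (i', j')))
      linarith [hcσ _ _ h']
    · have := dist_triangle_left (g (c (i, j))) (w (c (i', j'))) (w (c (i, j)))
      linarith [hcσ _ _ h]
    · have h1 := hg.dist_le_mul _ (hcb _ h) _ (hcb _ h')
      have h2 : (τ : ℝ) * dist (c (i, j)) (c (i', j')) ≤ τ := mul_le_of_le_one_right τ.2 hd'
      have h3 : (τ : ℝ) < K := hτ
      linarith
  have hedge : ∀ (i j i' j' : ℤ) (ℓ : ℝ → ℝ × ℝ), LipschitzWith 1 ℓ → ℓ 0 = ((i : ℝ), (j : ℝ)) →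
      ℓ 1 = ((i' : ℝ), (j' : ℝ)) → ∃ e : ℝ → X, LipschitzOnWith K e (Icc 0 1) ∧ e 0 = v i j ∧ e 1 = v i' j' ∧
        ((∀ t ∈ Icc (0 : ℝ) 1, ¬ inner (ℓ t)) → ∀ t ∈ Icc (0 : ℝ) 1, e t = g (c (ℓ t))) := by
    intro i j i' j' ℓ hℓ h0 h1
    by_cases hout : ∀ t ∈ Icc (0 : ℝ) 1, ¬ inner (ℓ t)
    · refine ⟨fun t ↦ g (c (ℓ t)), ?_, ?_, ?_, fun _ _ _ ↦ rfl⟩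
      · have h2 : LipschitzWith 1 (c ∘ ℓ) := by
          simpa using (lipschitzWith_clampSquare (N : ℝ)).comp hℓ
        have := hg.comp (h2.lipschitzOnWith (s := Icc 0 1)) fun t ht ↦ hcb _ (hout t ht)
        rw [mul_one] at this
        exact this.weaken hτ.le
      · have := hout 0 (by simp)
        rw [h0] at this
        simp only [v, h0, if_neg this]
      · have := hout 1 (by simp)
        rw [h1] at this
        simp only [v, h1, if_neg this]
    · have hd : dist ((i : ℝ), (j : ℝ)) ((i' : ℝ), (j' : ℝ)) ≤ 1 := by
        have := hℓ.dist_le_mul 0 1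
        rw [h0, h1] at this
        simpa using this
      obtain ⟨p, hp, hp0, hp1⟩ := hX _ _ K (hv _ _ _ _ hd)
      exact ⟨p, hp.lipschitzOnWith, hp0, hp1, fun h ↦ absurd h hout⟩
  have hlh : ∀ i j : ℤ, LipschitzWith 1 fun t : ℝ ↦ ((i + t : ℝ), (j : ℝ)) := fun i j ↦
    LipschitzWith.of_dist_le_mul fun s t ↦ by simp [Prod.dist_eq]
  have hlv : ∀ i j : ℤ, LipschitzWith 1 fun t : ℝ ↦ ((i : ℝ), (j + t : ℝ)) := fun i j ↦
    LipschitzWith.of_dist_le_mul fun s t ↦ by simp [Prod.dist_eq]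
  have hh := fun i j : ℤ ↦ hedge i j (i + 1) j _ (hlh i j) (by simp) (by simp)
  have hvv := fun i j : ℤ ↦ hedge i j i (j + 1) _ (hlv i j) (by simp) (by simp)
  choose eh heh heh0 heh1 hehg using hh
  choose ev hev hev0 hev1 hevg using hvv
  obtain ⟨F, hF, hFe⟩ := exists_lipschitzWith_of_grid hfill
    (fun i j ↦ ⟨heh i j, heh0 i j, heh1 i j⟩) (fun i j ↦ ⟨hev i j, hev0 i j, hev1 i j⟩)
  refine ⟨F, hF, ?_⟩
  rintro ⟨x, y⟩ ⟨hx, hy, hxy⟩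
  simp only at hx hy hxy
  have hcp : c (x, y) = (x, y) := clampSquare_of_mem hx hy
  have hfr : ∀ x : ℝ, Int.fract x ∈ Icc (0 : ℝ) 1 := fun x ↦
    ⟨Int.fract_nonneg x, (Int.fract_lt_one x).le⟩
  rcases hxy with hy' | hx'
  · obtain ⟨j, rfl⟩ : ∃ j : ℤ, (j : ℝ) = y := by
      rcases hy' with rfl | rfl
      exacts [⟨0, by simp⟩, ⟨N, by simp⟩]
    have h1 := (hFe ⌊x⌋ j _ (hfr x)).1
    rw [hehg _ _ (fun t _ h ↦ by rcases hy' with h' | h' <;> simp [inner, h'] at h) _ (hfr x),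
      Int.floor_add_fract, hcp] at h1
    exact h1
  · obtain ⟨i, rfl⟩ : ∃ i : ℤ, (i : ℝ) = x := by
      rcases hx' with rfl | rfl
      exacts [⟨0, by simp⟩, ⟨N, by simp⟩]
    have h1 := (hFe i ⌊y⌋ _ (hfr y)).2
    rw [hevg _ _ (fun t _ h ↦ by rcases hx' with h' | h' <;> simp [inner, h'] at h) _ (hfr y),
      Int.floor_add_fract, hcp] at h1
    exact h1

end GridFilling

section LocalFilling

variable {E : Type*} [NormedAddCommGroup E] [NormedSpace ℝ E] [FiniteDimensional ℝ E]
  {H : Type*} [TopologicalSpace H] (I : ModelWithCorners ℝ E H) [I.Boundaryless]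
  {M : Type*} [MetricSpace M] [ChartedSpace H M]
  [Bundle.RiemannianBundle (fun x : M ↦ TangentSpace I x)]
  [IsManifold I 1 M] [IsContinuousRiemannianBundle E (fun x : M ↦ TangentSpace I x)]

/-- In a homogeneous Riemannian manifold, small loops have fillings with linear bounds. -/
theorem IsHomogeneousMetricSpace.exists_squareFills_small [IsRiemannianManifold I M]
    [Nonempty M] (hM : IsHomogeneousMetricSpace M) :
    ∃ ρ > 0, ∃ C : ℝ≥0, ∀ L ≤ ρ, SquareFills M L (C * L) := by
  obtain ⟨x₀⟩ := ‹Nonempty M›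
  obtain ⟨C₁, r₁, hr₁, hs₁, h₁⟩ := exists_lipschitzOnWith_extChartAt I x₀
  obtain ⟨C₂, r₂, hr₂, hs₂, h₂⟩ := exists_lipschitzOnWith_extChartAt_symm I x₀
  set φ := extChartAt I x₀
  set A := lipschitzExtensionConstant E
  lift r₁ to ℝ≥0 using hr₁.le
  lift r₂ to ℝ≥0 using hr₂.le
  have hr₁' : 0 < r₁ := hr₁
  have hr₂' : 0 < r₂ := hr₂
  refine ⟨min (r₁ / 2) (r₂ / (2 * (A * C₁ + 1))), by positivity, C₂ * (A * C₁), fun L hL g hg ↦ ?_⟩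
  have hL₁ : L < r₁ := (hL.trans (min_le_left _ _)).trans_lt (NNReal.half_lt_self hr₁'.ne')
  have hL₂ : A * C₁ * L < r₂ := by
    have h3 := hL.trans (min_le_right _ _)
    rw [le_div_iff₀ (by positivity)] at h3
    have h4 : A * C₁ * L ≤ (A * C₁ + 1) * L := by gcongr; simp
    have h5 : 2 * ((A * C₁ + 1) * L) ≤ r₂ := by
      calc _ = L * (2 * (A * C₁ + 1)) := by ring
        _ ≤ _ := h3
    rcases eq_or_ne L 0 with rfl | h0
    · simpa using hr₂'
    · have h6 : 0 < (A * C₁ + 1) * L := mul_pos (by positivity) (pos_iff_ne_zero.2 h0)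
      refine h4.trans_lt (lt_of_lt_of_le ?_ h5)
      rw [two_mul]; exact lt_add_of_pos_left _ h6
  have hzero : ((0 : ℝ), (0 : ℝ)) ∈ squareBoundary 1 := by simp [squareBoundary]
  have hdist : ∀ p : ℝ × ℝ, p.1 ∈ Icc (0 : ℝ) 1 → p.2 ∈ Icc (0 : ℝ) 1 →
      dist p ((0 : ℝ), (0 : ℝ)) ≤ 1 := by
    rintro ⟨x, y⟩ hx hy
    simp only at hx hy
    simp [Prod.dist_eq, abs_of_nonneg hx.1, abs_of_nonneg hy.1, hx.2, hy.2]
  obtain ⟨e, he⟩ := hM (g (0, 0)) x₀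
  have hg' : LipschitzOnWith L (fun p ↦ e (g p)) (squareBoundary 1) := by
    simpa [Function.comp_def] using e.isometry.lipschitz.comp_lipschitzOnWith hg
  have hgball : MapsTo (fun p ↦ e (g p)) (squareBoundary 1) (ball x₀ r₁) := by
    intro p hp
    have h3 := hg'.dist_le_mul p hp _ hzero
    simp only [he] at h3
    refine (h3.trans (mul_le_of_le_one_right L.2 (hdist p hp.1 hp.2.1))).trans_lt ?_
    exact hL₁
  obtain ⟨G, hG, hGeq⟩ := (h₁.comp hg' hgball).extend_finite_dimension
  have hG' : LipschitzWith (A * C₁ * L) G := by rw [mul_assoc]; exact hG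
  have hG0 : G (0, 0) = φ x₀ := by rw [← hGeq hzero]; simp [he]
  have hGball : ∀ p, G (clampSquare 1 p) ∈ ball (φ x₀) r₂ := by
    intro p
    have h3 := hG'.dist_le_mul (clampSquare 1 p) (0, 0)
    rw [hG0] at h3
    refine (h3.trans (mul_le_of_le_one_right (by positivity) (hdist _ ?_ ?_))).trans_lt ?_
    · exact ⟨le_max_left _ _, by simp [clampSquare]⟩
    · exact ⟨le_max_left _ _, by simp [clampSquare]⟩
    · exact hL₂
  refine ⟨fun p ↦ e.symm (φ.symm (G (clampSquare 1 p))), ?_, fun p hp ↦ ?_⟩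
  · have h3 := (hG'.comp (lipschitzWith_clampSquare 1)).lipschitzOnWith (s := univ)
    have h4 := e.symm.isometry.lipschitz.comp_lipschitzOnWith
      (h₂.comp h3 fun p _ ↦ hGball p)
    rw [lipschitzOnWith_univ] at h4
    rw [one_mul, mul_one, ← mul_assoc] at h4
    exact h4
  · simp only
    rw [clampSquare_of_mem hp.1 hp.2.1, ← hGeq hp]
    simp only [Function.comp]
    rw [φ.left_inv (hs₁ (hgball hp)), e.symm_apply_apply]

end LocalFilling

section Proper

variable {X : Type*} [MetricSpace X]

theorem IsHomogeneousMetricSpace.properSpace [LocallyCompactSpace X]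
    (hX : IsHomogeneousMetricSpace X) (hp : HasLipschitzPaths X) : ProperSpace X := by
  rcases isEmpty_or_nonempty X with hE | ⟨⟨x₀⟩⟩
  · exact ⟨fun x ↦ (hE.false x).elim⟩
  obtain ⟨r, hr, hc₀⟩ := Metric.exists_isCompact_closedBall x₀
  have hc : ∀ x : X, IsCompact (closedBall x r) := by
    intro x
    obtain ⟨e, rfl⟩ := hX x₀ x
    rw [← e.image_closedBall]
    exact hc₀.image e.continuous
  have main : ∀ (x : X) (n : ℕ), IsCompact (closedBall x (n * (r / 2))) := by
    intro x n
    induction n with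
    | zero => simp
    | succ n ih =>
      obtain ⟨t, -, htf, ht⟩ := ih.finite_cover_balls (e := r / 4) (by positivity)
      refine (htf.isCompact_biUnion fun z _ ↦ hc z).of_isClosed_subset isClosed_closedBall ?_
      intro y hy
      obtain ⟨z, hz, hzy⟩ : ∃ z, dist z x ≤ n * (r / 2) ∧ dist z y ≤ 3 * r / 4 := by
        rcases le_or_gt (dist y x) (n * (r / 2)) with h | h
        · exact ⟨y, h, by simp; positivity⟩
        · rw [mem_closedBall] at hy
          set ℓ : ℝ≥0 := ⟨dist x y + r / 4, by positivity⟩ with hℓ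
          have hℓ' : (ℓ : ℝ) = dist x y + r / 4 := rfl
          obtain ⟨p, hpl, hp0, hp1⟩ := hp x y ℓ (by rw [hℓ']; linarith)
          have hpos : (0 : ℝ) < ℓ := by rw [hℓ']; positivity
          rw [dist_comm] at h hy
          have ht1 : n * (r / 2) / ℓ ≤ 1 := by rw [div_le_one hpos, hℓ']; linarith
          have ht0 : 0 ≤ n * (r / 2) / ℓ := by positivity
          have e : (ℓ : ℝ) * (n * (r / 2) / ℓ) = n * (r / 2) := mul_div_cancel₀ _ hpos.ne'
          refine ⟨p (n * (r / 2) / ℓ), ?_, ?_⟩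
          · have := hpl.dist_le_mul (n * (r / 2) / ℓ) 0
            rwa [hp0, Real.dist_eq, sub_zero, abs_of_nonneg ht0, e] at this
          · have := hpl.dist_le_mul (n * (r / 2) / ℓ) 1
            rw [hp1, dist_comm _ (1 : ℝ), Real.dist_eq, abs_of_nonneg (sub_nonneg.2 ht1), mul_sub, e,
              mul_one] at this
            push_cast at hy
            linarith
      obtain ⟨c, hct, hcz⟩ := mem_iUnion₂.1 (ht (mem_closedBall.2 hz))
      refine mem_iUnion₂.2 ⟨c, hct, ?_⟩
      have := dist_triangle_left y c z
      rw [mem_ball] at hcz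
      rw [mem_closedBall]
      linarith
  refine ⟨fun x R ↦ ?_⟩
  obtain ⟨n, hn⟩ := exists_nat_ge (R / (r / 2))
  refine (main x n).of_isClosed_subset isClosed_closedBall (closedBall_subset_closedBall ?_)
  rwa [div_le_iff₀ (by positivity)] at hn

end Proper

section ContinuousFilling

open unitInterval

theorem convexCombination_min_max_mem {s t : ℝ} (hs : s ∈ I) (ht : t ∈ I) :
    (1 - s) * min (2 * t) 1 + s * max (2 * t - 1) 0 ∈ I := by
  have h3 : 0 ≤ min (2 * t) 1 := le_min (by linarith [ht.1]) zero_le_one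
  have h4 : min (2 * t) 1 ≤ 1 := min_le_right _ _
  have h5 : 0 ≤ max (2 * t - 1) 0 := le_max_right _ _
  have h6 : max (2 * t - 1) 0 ≤ 1 := max_le (by linarith [ht.2]) zero_le_one
  constructor <;> nlinarith [hs.1, hs.2]

/-- The unit square swept out by its antidiagonals. -/
noncomputable def antidiagonalSweep (u : I × I) : I × I :=
  (⟨(1 - u.1) * min (2 * (u.2 : ℝ)) 1 + u.1 * max (2 * (u.2 : ℝ) - 1) 0,
      convexCombination_min_max_mem u.1.2 u.2.2⟩,
   ⟨(1 - (1 - u.1)) * min (2 * (u.2 : ℝ)) 1 + (1 - u.1) * max (2 * (u.2 : ℝ) - 1) 0,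
      convexCombination_min_max_mem (unitInterval.symm u.1).2 u.2.2⟩)

theorem min_add_max_two_mul (t : ℝ) : min (2 * t) 1 + max (2 * t - 1) 0 = 2 * t := by
  rcases le_total (2 * t) 1 with h | h
  · rw [min_eq_left h, max_eq_right (by linarith)]; ring
  · rw [min_eq_right h, max_eq_left (by linarith)]; ring

theorem continuous_antidiagonalSweep : Continuous antidiagonalSweep := by
  unfold antidiagonalSweep
  fun_prop

theorem antidiagonalSweep_surjective : Function.Surjective antidiagonalSweep := by
  rintro ⟨⟨x, hx0, hx1⟩, ⟨y, hy0, hy1⟩⟩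
  set t := (x + y) / 2 with ht
  set a := min (2 * t) 1 with ha
  set b := max (2 * t - 1) 0 with hb
  have hab : a + b = x + y := by rw [ha, hb, min_add_max_two_mul, ht]; ring
  have hxa : x ≤ a := le_min (by rw [ht]; linarith) hx1
  have hbx : b ≤ x := max_le (by rw [ht]; linarith) hx0
  obtain ⟨s, hs, hsx⟩ : ∃ s : ℝ, s ∈ Icc (0 : ℝ) 1 ∧ (1 - s) * a + s * b = x := by
    rcases (hbx.trans hxa).eq_or_lt with h | h
    · exact ⟨0, by simp, by linarith⟩
    · refine ⟨(a - x) / (a - b), ⟨div_nonneg (by linarith) (by linarith),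
        (div_le_one (by linarith)).2 (by linarith)⟩, ?_⟩
      have : a - b ≠ 0 := by linarith
      field_simp
      ring
  refine ⟨(⟨s, hs⟩, ⟨t, by constructor <;> linarith⟩), ?_⟩
  refine Prod.ext (Subtype.ext ?_) (Subtype.ext ?_)
  · exact hsx
  · change (1 - (1 - s)) * a + (1 - s) * b = y
    linarith

theorem antidiagonalSweep_eq {u w : I × I} (h : antidiagonalSweep u = antidiagonalSweep w) :
    u.2 = w.2 ∧ (u.1 = w.1 ∨ u.2 = 0 ∨ u.2 = 1) := by
  have h1 := congrArg (fun z : I × I ↦ (z.1 : ℝ)) h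
  have h2 := congrArg (fun z : I × I ↦ (z.2 : ℝ)) h
  simp only [antidiagonalSweep] at h1 h2
  have e1 := min_add_max_two_mul u.2
  have e2 := min_add_max_two_mul w.2
  have e : (u.2 : ℝ) = w.2 := by linarith
  refine ⟨Subtype.ext e, ?_⟩
  rw [e] at h1
  by_contra! hcon
  obtain ⟨c1, c2, c3⟩ := hcon
  have d2 : 0 < (w.2 : ℝ) := e ▸ lt_of_le_of_ne u.2.2.1 fun h ↦ c2 (Subtype.ext h.symm)
  have d3 : (w.2 : ℝ) < 1 := e ▸ lt_of_le_of_ne u.2.2.2 fun h ↦ c3 (Subtype.ext h)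
  have hlt : max (2 * w.2 - 1 : ℝ) 0 < min (2 * w.2 : ℝ) 1 :=
    max_lt (lt_min (by linarith) (by linarith)) (lt_min (by linarith) one_pos)
  apply c1
  apply Subtype.ext
  have : ((u.1 : ℝ) - w.1) * (min (2 * w.2 : ℝ) 1 - max (2 * w.2 - 1 : ℝ) 0) = 0 := by linarith
  rcases mul_eq_zero.1 this with h | h <;> linarith

theorem exists_uniformContinuous_filling {X : Type*} [MetricSpace X] [SimplyConnectedSpace X]
    {g : ℝ × ℝ → X} (hg : ContinuousOn g (squareBoundary 1)) :
    ∃ f : ℝ × ℝ → X, UniformContinuous f ∧ EqOn f g (squareBoundary 1) := by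
  have hab : ∀ t : I, ((min (2 * t : ℝ) 1, max (2 * t - 1 : ℝ) 0) : ℝ × ℝ) ∈ squareBoundary 1 ∧
      ((max (2 * t - 1 : ℝ) 0, min (2 * t : ℝ) 1) : ℝ × ℝ) ∈ squareBoundary 1 := by
    intro t
    have h2 := t.2
    have h3 : (0 : ℝ) ≤ min (2 * t : ℝ) 1 := le_min (by linarith [h2.1]) zero_le_one
    have h4 : min (2 * t : ℝ) 1 ≤ 1 := min_le_right _ _
    have h5 : (0 : ℝ) ≤ max (2 * t - 1 : ℝ) 0 := le_max_right _ _
    have h6 : max (2 * t - 1 : ℝ) 0 ≤ 1 := max_le (by linarith [h2.2]) zero_le_one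
    have h7 : max (2 * t - 1 : ℝ) 0 = 0 ∨ min (2 * t : ℝ) 1 = 1 := by
      rcases le_total (2 * t : ℝ) 1 with h | h
      · exact Or.inl (max_eq_right (by linarith))
      · exact Or.inr (min_eq_right h)
    constructor
    · exact ⟨⟨h3, h4⟩, ⟨h5, h6⟩, by tauto⟩
    · exact ⟨⟨h5, h6⟩, ⟨h3, h4⟩, by tauto⟩
  let p : Path (g (0, 0)) (g (1, 1)) :=
    { toFun := fun t ↦ g (min (2 * t : ℝ) 1, max (2 * t - 1 : ℝ) 0)
      continuous_toFun := hg.comp_continuous (by fun_prop) fun t ↦ (hab t).1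
      source' := by simp
      target' := by norm_num }
  let q : Path (g (0, 0)) (g (1, 1)) :=
    { toFun := fun t ↦ g (max (2 * t - 1 : ℝ) 0, min (2 * t : ℝ) 1)
      continuous_toFun := hg.comp_continuous (by fun_prop) fun t ↦ (hab t).2
      source' := by simp
      target' := by norm_num }
  obtain ⟨H⟩ := SimplyConnectedSpace.paths_homotopic p q
  have hquot : IsQuotientMap antidiagonalSweep :=
    continuous_antidiagonalSweep.isClosedMap.isQuotientMap continuous_antidiagonalSweep
      antidiagonalSweep_surjective
  let sec := Function.surjInv antidiagonalSweep_surjective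
  let G : I × I → X := fun z ↦ H (sec z)
  have hGH : ∀ u, G (antidiagonalSweep u) = H u := by
    intro u
    have h := antidiagonalSweep_eq (Function.surjInv_eq antidiagonalSweep_surjective
      (antidiagonalSweep u))
    change H (sec (antidiagonalSweep u)) = H u
    change (sec (antidiagonalSweep u)).2 = u.2 ∧ ((sec (antidiagonalSweep u)).1 = u.1 ∨
      (sec (antidiagonalSweep u)).2 = 0 ∨ (sec (antidiagonalSweep u)).2 = 1) at h
    obtain ⟨w1, w2⟩ := u
    generalize sec (antidiagonalSweep (w1, w2)) = z at h
    obtain ⟨z1, z2⟩ := z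
    simp only at h
    obtain ⟨rfl, rfl | rfl | rfl⟩ := h
    · rfl
    · rw [H.source, H.source]
    · rw [H.target, H.target]
  have hG : Continuous G := by
    rw [hquot.continuous_iff]
    have : G ∘ antidiagonalSweep = H := funext hGH
    rw [this]
    exact H.continuous
  let f : ℝ × ℝ → X := fun z ↦ G (projIcc 0 1 zero_le_one z.1, projIcc 0 1 zero_le_one z.2)
  have hf : ∀ (z : I × I) , f ((z.1 : ℝ), (z.2 : ℝ)) = G z := by
    intro z
    simp [f]
  refine ⟨f, ?_, ?_⟩
  · have h1 := (LipschitzWith.projIcc (zero_le_one : (0 : ℝ) ≤ 1)).uniformContinuous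
    exact (CompactSpace.uniformContinuous_of_continuous hG).comp
      ((h1.comp uniformContinuous_fst).prodMk (h1.comp uniformContinuous_snd))
  · have k1 : ∀ t : I, f (min (2 * t : ℝ) 1, max (2 * t - 1 : ℝ) 0) =
        g (min (2 * t : ℝ) 1, max (2 * t - 1 : ℝ) 0) := by
      intro t
      have h1 := hGH (0, t)
      rw [H.apply_zero] at h1
      rw [← hf] at h1
      simpa [antidiagonalSweep, p] using h1
    have k2 : ∀ t : I, f (max (2 * t - 1 : ℝ) 0, min (2 * t : ℝ) 1) =
        g (max (2 * t - 1 : ℝ) 0, min (2 * t : ℝ) 1) := by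
      intro t
      have h1 := hGH (1, t)
      rw [H.apply_one] at h1
      rw [← hf] at h1
      simpa [antidiagonalSweep, q] using h1
    have lo : ∀ x ∈ Icc (0 : ℝ) 1, ∃ t : I, min (2 * t : ℝ) 1 = x ∧ max (2 * t - 1 : ℝ) 0 = 0 := by
      intro x hx
      refine ⟨⟨x / 2, by linarith [hx.1], by linarith [hx.2]⟩, ?_, ?_⟩
      · rw [min_eq_left] <;> simp only <;> linarith [hx.2]
      · rw [max_eq_right]; simp only; linarith [hx.2]
    have hi : ∀ x ∈ Icc (0 : ℝ) 1, ∃ t : I, min (2 * t : ℝ) 1 = 1 ∧ max (2 * t - 1 : ℝ) 0 = x := by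
      intro x hx
      refine ⟨⟨(1 + x) / 2, by linarith [hx.1], by linarith [hx.2]⟩, ?_, ?_⟩
      · rw [min_eq_right]; simp only; linarith [hx.1]
      · rw [max_eq_left] <;> simp only <;> linarith [hx.1]
    rintro ⟨x, y⟩ ⟨hx, hy, h⟩
    simp only at hx hy h
    rcases h with (rfl | rfl) | (rfl | rfl)
    · obtain ⟨t, ht1, ht2⟩ := lo x hx
      have := k1 t; rwa [ht1, ht2] at this
    · obtain ⟨t, ht1, ht2⟩ := hi x hx
      have := k2 t; rwa [ht1, ht2] at this
    · obtain ⟨t, ht1, ht2⟩ := lo y hy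
      have := k2 t; rwa [ht1, ht2] at this
    · obtain ⟨t, ht1, ht2⟩ := hi y hy
      have := k1 t; rwa [ht1, ht2] at this

end ContinuousFilling

section UniformFilling

variable {X : Type*} [MetricSpace X]

theorem smul_mem_squareBoundary {a b : ℝ} (ha : 0 < a) {p : ℝ × ℝ} (hp : p ∈ squareBoundary b) :
    a • p ∈ squareBoundary (a * b) := by
  obtain ⟨h1, h2, h3⟩ := hp
  refine ⟨⟨mul_nonneg ha.le h1.1, mul_le_mul_of_nonneg_left h1.2 ha.le⟩,
    ⟨mul_nonneg ha.le h2.1, mul_le_mul_of_nonneg_left h2.2 ha.le⟩, ?_⟩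
  simpa [ha.ne'] using h3

theorem isCompact_squareBoundary (a : ℝ) : IsCompact (squareBoundary a) := by
  have : squareBoundary a = (Icc 0 a ×ˢ Icc 0 a) ∩
      {p | (p.2 = 0 ∨ p.2 = a) ∨ (p.1 = 0 ∨ p.1 = a)} := by
    ext p; simp only [squareBoundary, mem_inter_iff, mem_prod, mem_ofPred_eq, and_assoc]
  rw [this]
  refine (isCompact_Icc.prod isCompact_Icc).inter_right ?_
  exact ((isClosed_eq continuous_snd continuous_const).union
    (isClosed_eq continuous_snd continuous_const)).union
    ((isClosed_eq continuous_fst continuous_const).union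
    (isClosed_eq continuous_fst continuous_const))

theorem lipschitzWith_smul_prod (a : ℝ≥0) : LipschitzWith a fun p : ℝ × ℝ ↦ (a : ℝ) • p :=
  LipschitzWith.of_dist_le_mul fun p q ↦ by rw [dist_smul₀]; simp

/-- A uniformly continuous filling of a loop yields Lipschitz fillings of all nearby Lipschitz
loops, with a common Lipschitz constant. -/
theorem exists_lipschitz_filling_of_nearby (hX : HasLipschitzPaths X) {K C : ℝ≥0} (hK : 0 < K)
    (hfill : SquareFills X (3 * K) C) (R : ℝ≥0) {f : ℝ × ℝ → X} (hf : UniformContinuous f) :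
    ∃ M : ℝ≥0, ∀ g : ℝ × ℝ → X, LipschitzOnWith R g (squareBoundary 1) →
      (∀ p ∈ squareBoundary 1, dist (f p) (g p) ≤ K / 4) →
      ∃ F : ℝ × ℝ → X, LipschitzWith M F ∧ EqOn F g (squareBoundary 1) := by
  have hK' : (0 : ℝ) < K := hK
  obtain ⟨δ, hδ, hδf⟩ := Metric.uniformContinuous_iff.1 hf (K / 4) (by positivity)
  obtain ⟨N, hN⟩ := exists_nat_gt (max (1 / δ) (R / K : ℝ))
  have hN1 : 1 / δ < N := (le_max_left _ _).trans_lt hN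
  have hN2 : (R / K : ℝ) < N := (le_max_right _ _).trans_lt hN
  have hN0 : (0 : ℝ) < N := (by positivity : (0 : ℝ) < 1 / δ).trans hN1
  set a : ℝ≥0 := (N : ℝ≥0)⁻¹ with ha
  have ha' : (a : ℝ) = (N : ℝ)⁻¹ := by simp [ha]
  have ha0 : (0 : ℝ) < a := by rw [ha']; positivity
  have hmem : ∀ p ∈ squareBoundary N, (a : ℝ) • p ∈ squareBoundary 1 := by
    intro p hp
    have := smul_mem_squareBoundary ha0 hp
    rwa [ha', inv_mul_cancel₀ hN0.ne', ← ha'] at this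
  refine ⟨2 * C * N, fun g hg hfg ↦ ?_⟩
  have hτ : R * a < K := by
    rw [← NNReal.coe_lt_coe, NNReal.coe_mul, ha', ← div_eq_mul_inv, div_lt_iff₀ hN0]
    rwa [div_lt_iff₀ hK', mul_comm] at hN2
  have hw : ∀ p q : ℝ × ℝ, dist p q ≤ 1 → dist (f ((a : ℝ) • p)) (f ((a : ℝ) • q)) ≤ K / 4 := by
    intro p q hpq
    refine (hδf ?_).le
    rw [dist_smul₀, Real.norm_of_nonneg ha0.le, ha']
    calc (N : ℝ)⁻¹ * dist p q ≤ (N : ℝ)⁻¹ * 1 := by gcongr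
      _ < δ := by rw [mul_one]; exact inv_lt_of_inv_lt₀ hδ (by simpa using hN1)
  obtain ⟨F, hF, hFg⟩ := exists_filling_of_coarse_filling hX hfill N
    (g := fun p ↦ g ((a : ℝ) • p)) (w := fun p ↦ f ((a : ℝ) • p)) (τ := R * a) (ρ := K / 4)
    (σ := K / 4) (by positivity) hτ (by linarith)
    (hg.comp (lipschitzWith_smul_prod a).lipschitzOnWith hmem) hw
    fun i j hij ↦ hfg _ (hmem _ hij)
  refine ⟨fun p ↦ F ((N : ℝ) • p), ?_, fun p hp ↦ ?_⟩
  · have := hF.comp (lipschitzWith_smul_prod N)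
    simpa [Function.comp_def] using this
  · have h1 := smul_mem_squareBoundary hN0 hp
    rw [mul_one] at h1
    simp only
    rw [hFg h1]
    simp only
    rw [ha', inv_smul_smul₀ hN0.ne']

theorem IsHomogeneousMetricSpace.exists_squareFills [ProperSpace X] [SimplyConnectedSpace X]
    (hX : IsHomogeneousMetricSpace X) (hp : HasLipschitzPaths X) {K C : ℝ≥0} (hK : 0 < K)
    (hfill : SquareFills X (3 * K) C) (R : ℝ≥0) : ∃ M : ℝ≥0, SquareFills X R M := by
  classical
  obtain ⟨x₀⟩ : Nonempty X := inferInstance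
  let S := squareBoundary 1
  have : CompactSpace S := isCompact_iff_compactSpace.1 (isCompact_squareBoundary 1)
  have hzero : ((0 : ℝ), (0 : ℝ)) ∈ S := by simp [S, squareBoundary]
  let z : S := ⟨(0, 0), hzero⟩
  let A : Set (BoundedContinuousFunction S X) := {u | LipschitzWith R u ∧ u z = x₀}
  have hdist : ∀ s : S, dist s z ≤ 1 := by
    rintro ⟨⟨x, y⟩, hx, hy, -⟩
    simp only at hx hy
    simp [z, Subtype.dist_eq, Prod.dist_eq, abs_of_nonneg hx.1, abs_of_nonneg hy.1, hx.2, hy.2]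
  have hAcl : IsClosed A := by
    have : A = (⋂ (x : S) (y : S), {u : BoundedContinuousFunction S X |
        dist (u x) (u y) ≤ R * dist x y}) ∩ {u | u z = x₀} := by
      ext u
      simp [A, lipschitzWith_iff_dist_le_mul]
    rw [this]
    refine IsClosed.inter (isClosed_iInter fun x ↦ isClosed_iInter fun y ↦ ?_) ?_
    · exact isClosed_le ((continuous_eval_const (x := x)).dist
        (continuous_eval_const (x := y))) continuous_const
    · exact isClosed_eq (continuous_eval_const (x := z)) continuous_const
  have hA : IsCompact A := by
    refine BoundedContinuousFunction.arzela_ascoli₂ (closedBall x₀ R) (isCompact_closedBall _ _) A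
      hAcl ?_ ?_
    · intro u s hu
      have := hu.1.dist_le_mul s z
      rw [hu.2] at this
      exact this.trans (mul_le_of_le_one_right R.2 (hdist s))
    · exact (LipschitzWith.uniformEquicontinuous _ R fun u : A ↦ u.2.1).equicontinuous
  obtain ⟨M, hM⟩ : ∃ M : ℝ≥0, ∀ u ∈ A, u ∈ A → ∃ F : ℝ × ℝ → X, LipschitzWith M F ∧
      ∀ s : S, F s = u s := by
    refine hA.induction_on (p := fun T ↦ ∃ M : ℝ≥0, ∀ u ∈ T, u ∈ A → ∃ F : ℝ × ℝ → X,
      LipschitzWith M F ∧ ∀ s : S, F s = u s) ⟨0, by simp⟩ ?_ ?_ ?_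
    · rintro T T' hTT ⟨M, hM⟩
      exact ⟨M, fun u hu ↦ hM u (hTT hu)⟩
    · rintro T T' ⟨M, hM⟩ ⟨M', hM'⟩
      refine ⟨max M M', ?_⟩
      rintro u (hu | hu) huA
      · obtain ⟨F, hF, h⟩ := hM u hu huA
        exact ⟨F, hF.weaken (le_max_left _ _), h⟩
      · obtain ⟨F, hF, h⟩ := hM' u hu huA
        exact ⟨F, hF.weaken (le_max_right _ _), h⟩
    · intro u hu
      let ext : BoundedContinuousFunction S X → ℝ × ℝ → X := fun u p ↦
        if h : p ∈ S then u ⟨p, h⟩ else x₀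
      have hext : ∀ u (s : S), ext u s = u s := fun u s ↦ by simp [ext]
      have hextr : ∀ u, S.domRestrict (ext u) = u := fun u ↦ funext fun s ↦ hext u s
      have hcont : ContinuousOn (ext u) S := by
        rw [continuousOn_iff_continuous_domRestrict, hextr]; exact u.continuous
      obtain ⟨f, hf, hfu⟩ := exists_uniformContinuous_filling hcont
      obtain ⟨M, hM⟩ := exists_lipschitz_filling_of_nearby hp hK hfill R hf
      have hK' : (0 : ℝ) < K / 4 := by have : (0 : ℝ) < K := hK
                                       positivity
      refine ⟨ball u (K / 4), mem_nhdsWithin_of_mem_nhds (ball_mem_nhds _ hK'), M,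
        fun u' hu' hu'A ↦ ?_⟩
      have hlip : LipschitzOnWith R (ext u') S := by
        rw [lipschitzOnWith_iff_restrict, hextr]
        exact hu'A.1
      have hnear : ∀ p ∈ squareBoundary 1, dist (f p) (ext u' p) ≤ K / 4 := by
        intro p hpS
        rw [hfu hpS]
        have h1 := hext u ⟨p, hpS⟩
        have h2 := hext u' ⟨p, hpS⟩
        simp only at h1 h2
        rw [h1, h2, dist_comm]
        exact (BoundedContinuousFunction.dist_coe_le_dist _).trans (mem_ball.1 hu').le
      obtain ⟨F, hF, hFu⟩ := hM (ext u') hlip hnear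
      exact ⟨F, hF, fun s ↦ by rw [hFu s.2, hext]⟩
  refine ⟨M, fun g hg ↦ ?_⟩
  obtain ⟨e, he⟩ := hX (g (0, 0)) x₀
  have hg' : LipschitzWith R (S.domRestrict fun p ↦ e (g p)) := by
    have := (e.isometry.lipschitz.comp_lipschitzOnWith hg).to_restrict
    rwa [one_mul] at this
  let u : BoundedContinuousFunction S X :=
    BoundedContinuousFunction.mkOfCompact ⟨S.domRestrict fun p ↦ e (g p), hg'.continuous⟩
  have hu : u ∈ A := ⟨hg', he⟩
  obtain ⟨F, hF, hFu⟩ := hM u hu hu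
  refine ⟨fun p ↦ e.symm (F p), ?_, fun p hp ↦ ?_⟩
  · simpa [Function.comp_def] using e.symm.isometry.lipschitz.comp hF
  · have h1 := hFu ⟨p, hp⟩
    have h2 : u ⟨p, hp⟩ = e (g p) := rfl
    simp only at h1
    simp only
    rw [h1, h2, e.symm_apply_apply]

end UniformFilling

section RadialRescale

variable {E F : Type*} [NormedAddCommGroup E] [NormedSpace ℝ E] [NormedAddCommGroup F]
  [NormedSpace ℝ F]

/-- The norm-preserving map that agrees with the linear map `e` up to a positive factor. -/
noncomputable def radialRescale (e : E ≃L[ℝ] F) (x : E) : F := (‖x‖ / ‖e x‖) • e x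

theorem norm_radialRescale (e : E ≃L[ℝ] F) (x : E) : ‖radialRescale e x‖ = ‖x‖ := by
  rcases eq_or_ne x 0 with rfl | hx
  · simp [radialRescale]
  · have : ‖e x‖ ≠ 0 := by simpa using hx
    rw [radialRescale, norm_smul, norm_div, norm_norm, norm_norm, div_mul_cancel₀ _ this]

theorem radialRescale_symm_radialRescale (e : E ≃L[ℝ] F) (x : E) :
    radialRescale e.symm (radialRescale e x) = x := by
  rcases eq_or_ne x 0 with rfl | hx
  · simp [radialRescale]
  · have h1 : ‖e x‖ ≠ 0 := by simpa using hx
    have h2 : ‖x‖ ≠ 0 := by simpa using hx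
    rw [radialRescale, norm_radialRescale]
    simp only [radialRescale, map_smul, ContinuousLinearEquiv.symm_apply_apply, norm_smul,
      norm_div, norm_norm, smul_smul]
    rw [show ‖x‖ / (‖x‖ / ‖e x‖ * ‖x‖) * (‖x‖ / ‖e x‖) = 1 by field_simp, one_smul]

theorem exists_lipschitzWith_radialRescale (e : E ≃L[ℝ] F) :
    ∃ K : ℝ≥0, LipschitzWith K (radialRescale e) := by
  set A := ‖(e : E →L[ℝ] F)‖
  set B := ‖(e.symm : F →L[ℝ] E)‖
  have hA : ∀ x, ‖e x‖ ≤ A * ‖x‖ := (e : E →L[ℝ] F).le_opNorm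
  have hB : ∀ x, ‖x‖ ≤ B * ‖e x‖ := fun x ↦ by
    simpa using (e.symm : F →L[ℝ] E).le_opNorm (e x)
  have hA0 : 0 ≤ A := norm_nonneg _
  have hB0 : 0 ≤ B := norm_nonneg _
  refine ⟨⟨1 + 2 * A * B, by positivity⟩, LipschitzWith.of_dist_le_mul fun x y ↦ ?_⟩
  rw [dist_eq_norm, dist_eq_norm]
  change _ ≤ (1 + 2 * A * B) * ‖x - y‖
  have hn := norm_nonneg (x - y)
  have hAB : 0 ≤ A * B * ‖x - y‖ := by positivity
  rcases eq_or_ne y 0 with rfl | hy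
  · rw [show radialRescale e (0 : E) = 0 by simp [radialRescale], sub_zero, sub_zero,
      norm_radialRescale]
    rw [sub_zero] at hAB
    linarith
  have hey : 0 < ‖e y‖ := by simpa using hy
  set u : F := ‖e x‖⁻¹ • e x with hu
  have hun : ‖u‖ ≤ 1 := by
    rw [hu, norm_smul, norm_inv, norm_norm]
    exact inv_mul_le_one
  have hux : ‖e x‖ • u = e x := by
    rcases eq_or_ne (e x) 0 with h | h
    · simp [h, hu]
    · rw [hu, smul_inv_smul₀ (norm_ne_zero_iff.2 h)]
  have key : radialRescale e x - radialRescale e y =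
      (‖x‖ - ‖y‖) • u + (‖y‖ / ‖e y‖) • ((‖e y‖ - ‖e x‖) • u + (e x - e y)) := by
    have h1 : radialRescale e x = ‖x‖ • u := by
      rw [radialRescale, hu, smul_smul, div_eq_mul_inv]
    have h2 : ‖y‖ • u = (‖y‖ / ‖e y‖) • (‖e y‖ • u) := by
      rw [smul_smul (‖y‖ / ‖e y‖), div_mul_cancel₀ _ hey.ne']
    rw [h1, radialRescale, sub_smul, sub_smul, hux, h2]
    module
  have hexy : ‖e x - e y‖ ≤ A * ‖x - y‖ := by rw [← map_sub]; exact hA _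
  have hratio : ‖y‖ / ‖e y‖ ≤ B := by rw [div_le_iff₀ hey]; exact hB y
  have h3 : ‖(‖x‖ - ‖y‖) • u‖ ≤ ‖x - y‖ := by
    rw [norm_smul]
    calc _ ≤ ‖x - y‖ * 1 := by
          gcongr
          exact abs_norm_sub_norm_le x y
      _ = _ := mul_one _
  have h4 : ‖(‖e y‖ - ‖e x‖) • u‖ ≤ A * ‖x - y‖ := by
    rw [norm_smul]
    calc _ ≤ ‖e x - e y‖ * 1 := by
          gcongr
          rw [norm_sub_rev (e x)]
          exact abs_norm_sub_norm_le (e y) (e x)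
      _ ≤ _ := by rwa [mul_one]
  have h5 : ‖(‖y‖ / ‖e y‖) • ((‖e y‖ - ‖e x‖) • u + (e x - e y))‖ ≤
      B * (A * ‖x - y‖ + A * ‖x - y‖) := by
    rw [norm_smul, norm_div, norm_norm, norm_norm]
    gcongr
    exact (norm_add_le _ _).trans (add_le_add h4 hexy)
  rw [key]
  have := norm_add_le ((‖x‖ - ‖y‖) • u) ((‖y‖ / ‖e y‖) • ((‖e y‖ - ‖e x‖) • u + (e x - e y)))
  linarith

end RadialRescale

section DiskSquare

theorem norm_affine_le_one_iff {a : ℝ} (ha : 0 < a) (x : ℝ) :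
    ‖2 / a * x - 1‖ ≤ 1 ↔ x ∈ Icc 0 a := by
  rw [Real.norm_eq_abs, abs_le, mem_Icc]
  have h : 2 / a * x = 2 * x / a := by ring
  rw [h]
  constructor
  · rintro ⟨h1, h2⟩
    have h3 : 0 ≤ 2 * x / a := by linarith
    have h4 : 2 * x / a ≤ 2 := by linarith
    rw [div_le_iff₀ ha] at h4
    rw [le_div_iff₀ ha] at h3
    constructor <;> linarith
  · rintro ⟨h1, h2⟩
    have h3 : 0 ≤ 2 * x / a := by positivity
    have h4 : 2 * x / a ≤ 2 := by rw [div_le_iff₀ ha]; linarith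
    constructor <;> linarith

theorem norm_affine_eq_one_iff {a : ℝ} (ha : 0 < a) (x : ℝ) :
    ‖2 / a * x - 1‖ = 1 ↔ x = 0 ∨ x = a := by
  rw [Real.norm_eq_abs, abs_eq zero_le_one]
  have h : 2 / a * x = 2 * x / a := by ring
  rw [h, or_comm]
  refine or_congr ?_ ?_
  · rw [sub_eq_iff_eq_add, div_eq_iff ha.ne']
    constructor <;> intro h <;> linarith
  · rw [sub_eq_iff_eq_add, div_eq_iff ha.ne']
    constructor <;> intro h <;> linarith

/-- The square `[0, a] × [0, a]` and the unit disk are bilipschitz equivalent. -/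
theorem exists_bilipschitz_square_disk : ∃ B : ℝ≥0, ∀ a : ℝ≥0, 0 < a →
    ∃ (s : ℝ × ℝ → ℂ) (d : ℂ → ℝ × ℝ), LipschitzWith (B / a) s ∧ LipschitzWith (B * a) d ∧
      (∀ p, d (s p) = p) ∧ (∀ z, s (d z) = z) ∧ (∀ p, ‖s p‖ = 1 ↔ p ∈ squareBoundary a) ∧
      ∀ p : ℝ × ℝ, p.1 ∈ Icc 0 (a : ℝ) → p.2 ∈ Icc 0 (a : ℝ) → ‖s p‖ ≤ 1 := by
  let e : (ℝ × ℝ) ≃L[ℝ] ℂ := Complex.equivRealProdCLM.symm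
  obtain ⟨K₁, hK₁⟩ := exists_lipschitzWith_radialRescale e
  obtain ⟨K₂, hK₂⟩ := exists_lipschitzWith_radialRescale e.symm
  refine ⟨max (K₁ * 2) K₂, fun a ha ↦ ?_⟩
  have ha' : (0 : ℝ) < a := ha
  let T : ℝ × ℝ → ℝ × ℝ := fun p ↦ (2 / (a : ℝ)) • p - (1, 1)
  let T' : ℝ × ℝ → ℝ × ℝ := fun p ↦ ((a : ℝ) / 2) • (p + (1, 1))
  have hT : LipschitzWith (2 / a) T := LipschitzWith.of_dist_le_mul fun p q ↦ by
    simp only [T, dist_sub_right, dist_smul₀]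
    simp
  have hT' : LipschitzWith (a / 2) T' := LipschitzWith.of_dist_le_mul fun p q ↦ by
    simp only [T', dist_smul₀, dist_add_right]
    simp
  have hTT' : ∀ p, T' (T p) = p := fun p ↦ by
    simp only [T, T', sub_add_cancel, smul_smul]
    rw [div_mul_div_cancel₀ two_ne_zero, div_self ha'.ne', one_smul]
  have hT'T : ∀ p, T (T' p) = p := fun p ↦ by
    simp only [T, T', smul_smul]
    rw [div_mul_div_cancel₀ ha'.ne', div_self two_ne_zero, one_smul, add_sub_cancel_right]
  have hTn : ∀ p, ‖T p‖ = max ‖2 / (a : ℝ) * p.1 - 1‖ ‖2 / (a : ℝ) * p.2 - 1‖ := fun p ↦ by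
    simp [T, Prod.norm_def]
  refine ⟨fun p ↦ radialRescale e (T p), fun z ↦ T' (radialRescale e.symm z), ?_, ?_, ?_, ?_, ?_, ?_⟩
  · refine (hK₁.comp hT).weaken ?_
    rw [← mul_div_assoc]
    gcongr
    exact le_max_left _ _
  · refine (hT'.comp hK₂).weaken ?_
    rw [mul_comm]
    gcongr
    · exact le_max_right _ _
    · exact div_le_self a.2 one_le_two
  · intro p
    simp only [radialRescale_symm_radialRescale, hTT']
  · intro z
    simp only [hT'T]
    exact radialRescale_symm_radialRescale e.symm z
  · intro p
    rw [norm_radialRescale, hTn]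
    have h1 := norm_affine_le_one_iff ha' p.1
    have h2 := norm_affine_le_one_iff ha' p.2
    have h3 := norm_affine_eq_one_iff ha' p.1
    have h4 := norm_affine_eq_one_iff ha' p.2
    change _ ↔ (p.1 ∈ Icc 0 (a : ℝ) ∧ p.2 ∈ Icc 0 (a : ℝ) ∧
      ((p.2 = 0 ∨ p.2 = a) ∨ (p.1 = 0 ∨ p.1 = a)))
    rw [← h1, ← h2, ← h3, ← h4]
    constructor
    · intro h
      refine ⟨(le_max_left _ _).trans_eq h, (le_max_right _ _).trans_eq h, ?_⟩
      rcases max_choice ‖2 / (a : ℝ) * p.1 - 1‖ ‖2 / (a : ℝ) * p.2 - 1‖ with h' | h'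
      · exact Or.inr (h'.symm.trans h)
      · exact Or.inl (h'.symm.trans h)
    · rintro ⟨k1, k2, k3 | k3⟩
      · rw [k3]; exact max_eq_right k1
      · rw [k3]; exact max_eq_left k2
  · intro p h1 h2
    rw [norm_radialRescale, hTn]
    exact max_le ((norm_affine_le_one_iff ha' _).2 h1) ((norm_affine_le_one_iff ha' _).2 h2)

variable {X : Type*} [MetricSpace X]

theorem lipConst_le {A : Type*} [MetricSpace A] {f : A → X} {K : ℝ≥0} (hf : LipschitzWith K f) :
    lipConst f ≤ K :=
  iInf₂_le K hf

theorem fillingSpan_le {γ : UnitCircle → X} {f : UnitDisk → X} (hf : f ∘ circleToDisk = γ) :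
    fillingSpan γ ≤ lipConst f :=
  iInf₂_le f hf

theorem exists_lipschitzWith_eq_lipConst {A : Type*} [MetricSpace A] {f : A → X} {K : ℝ≥0}
    (hf : LipschitzWith K f) :
    ∃ L : ℝ≥0, LipschitzWith L f ∧ lipConst f = L := by
  have hle : lipConst f ≤ K := lipConst_le hf
  obtain ⟨L, hL⟩ := WithTop.ne_top_iff_exists.1 (ne_top_of_le_ne_top ENNReal.coe_ne_top hle)
  replace hL : (L : ℝ≥0∞) = lipConst f := hL
  refine ⟨L, fun x y ↦ ?_, hL.symm⟩
  rw [hL]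
  rcases eq_or_ne (edist x y) 0 with h0 | h0
  · have := hf x y
    rw [h0, mul_zero] at this
    rw [h0, mul_zero]; exact this
  · rw [← ENNReal.div_le_iff h0 (edist_ne_top x y)]
    refine le_iInf₂ fun K' hK' ↦ ?_
    rw [ENNReal.div_le_iff h0 (edist_ne_top x y)]
    exact hK' x y

theorem LipschitzOneConnected.exists_filling_square (hX : LipschitzOneConnected X) :
    ∃ C : ℝ≥0, ∀ a : ℝ≥0, 0 < a → ∀ L : ℝ≥0, 0 < L → ∀ g : ℝ × ℝ → X,
      LipschitzOnWith L g (squareBoundary a) →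
      ∃ f : ℝ × ℝ → X, LipschitzWith (C * L) f ∧ EqOn f g (squareBoundary a) := by
  obtain ⟨C, hC⟩ := hX
  obtain ⟨B, hB⟩ := exists_bilipschitz_square_disk
  refine ⟨(C + 1) * (B + 1) * B, fun a ha L hL g hg ↦ ?_⟩
  obtain ⟨s, d, hs, hd, hds, hsd, hbd, hdisk⟩ := hB a ha
  let γ : UnitCircle → X := fun θ ↦ g (d θ)
  have hmem : ∀ θ : UnitCircle, d θ ∈ squareBoundary a := fun θ ↦ by
    rw [← hbd, hsd]; simp
  have hγ : LipschitzWith (L * ((B + 1) * a)) γ := by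
    have h1 : LipschitzWith ((B + 1) * a) fun θ : UnitCircle ↦ d θ := by
      have := hd.comp (LipschitzWith.subtype_val (sphere (0 : ℂ) 1))
      rw [mul_one] at this
      exact this.weaken (by gcongr; simp)
    have := hg.comp (h1.lipschitzOnWith (s := univ)) fun θ _ ↦ hmem θ
    rwa [lipschitzOnWith_univ] at this
  have hpos : 0 < L * ((B + 1) * a) := by positivity
  have hspan : fillingSpan γ < ((C + 1) * (L * ((B + 1) * a)) : ℝ≥0) := by
    refine (hC γ ⟨_, hγ⟩).trans_lt ?_
    have h1 : lipConst γ ≤ (L * ((B + 1) * a) : ℝ≥0) := lipConst_le hγ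
    refine (mul_le_mul_right h1 _).trans_lt ?_
    rw [← ENNReal.coe_mul, ENNReal.coe_lt_coe, add_one_mul C]
    exact lt_add_of_pos_right _ hpos
  simp only [fillingSpan, lipConst, iInf_lt_iff] at hspan
  obtain ⟨f, hfγ, K, hK, hKlt⟩ := hspan
  rw [ENNReal.coe_lt_coe] at hKlt
  have hin : ∀ p, s (clampSquare a p) ∈ closedBall (0 : ℂ) 1 := fun p ↦ by
    rw [mem_closedBall_zero_iff]
    exact hdisk _ ⟨le_max_left _ _, by simp [clampSquare]⟩ ⟨le_max_left _ _, by simp [clampSquare]⟩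
  refine ⟨fun p ↦ f ⟨s (clampSquare a p), hin p⟩, ?_, fun p hp ↦ ?_⟩
  · have h1 : LipschitzWith (B / a) fun p ↦ (⟨s (clampSquare a p), hin p⟩ : UnitDisk) := by
      have := hs.comp (lipschitzWith_clampSquare a)
      rw [mul_one] at this
      exact this.subtype_mk hin
    refine ((hK.weaken hKlt.le).comp h1).weaken (le_of_eq ?_)
    field_simp
  · have h1 : ‖s p‖ = 1 := (hbd p).2 hp
    have h2 := congrFun hfγ ⟨s p, by simpa using h1⟩
    simp only [γ, hds, Function.comp] at h2
    rw [← h2]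
    simp only [clampSquare_of_mem hp.1 hp.2.1]
    rfl

theorem lipschitzOneConnected_of_squareFills {C : ℝ≥0} (h : ∀ L, SquareFills X L (C * L)) :
    LipschitzOneConnected X := by
  classical
  obtain ⟨B, hB⟩ := exists_bilipschitz_square_disk
  obtain ⟨s, d, hs, hd, hds, hsd, hbd, -⟩ := hB 1 one_pos
  rw [div_one] at hs
  rw [mul_one] at hd
  refine ⟨C * B * B, fun γ ⟨K, hK⟩ ↦ ?_⟩
  obtain ⟨L, hL, hLe⟩ := exists_lipschitzWith_eq_lipConst hK
  let θ₀ : UnitCircle := ⟨1, by simp⟩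
  let g : ℝ × ℝ → X := fun p ↦ if h : s p ∈ sphere (0 : ℂ) 1 then γ ⟨s p, h⟩ else γ θ₀
  have hgθ : ∀ θ : UnitCircle, g (d θ) = γ θ := by
    intro θ
    have : s (d θ) ∈ sphere (0 : ℂ) 1 := by rw [hsd]; exact θ.2
    simp only [g, dif_pos this]
    congr 1
    exact Subtype.ext (hsd θ)
  have hg : LipschitzOnWith (L * B) g (squareBoundary 1) := by
    refine LipschitzOnWith.of_dist_le_mul fun p hp q hq ↦ ?_
    have hp' : s p ∈ sphere (0 : ℂ) 1 := by simpa using (hbd p).2 hp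
    have hq' : s q ∈ sphere (0 : ℂ) 1 := by simpa using (hbd q).2 hq
    simp only [g, dif_pos hp', dif_pos hq']
    refine (hL.dist_le_mul _ _).trans ?_
    rw [Subtype.dist_eq, NNReal.coe_mul, mul_assoc]
    exact mul_le_mul_of_nonneg_left (hs.dist_le_mul p q) L.2
  obtain ⟨f, hf, hfg⟩ := h _ g hg
  have hfill : LipschitzWith (C * (L * B) * B) fun z : UnitDisk ↦ f (d z) := by
    have := (hf.comp hd).comp (LipschitzWith.subtype_val (closedBall (0 : ℂ) 1))
    rwa [mul_one] at this
  have hrestr : (fun z : UnitDisk ↦ f (d z)) ∘ circleToDisk = γ := by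
    funext θ
    change f (d θ) = γ θ
    have hθ : d θ ∈ squareBoundary 1 := (hbd _).1 (by rw [hsd]; simp)
    rw [hfg hθ, hgθ]
  refine (fillingSpan_le hrestr).trans ((lipConst_le hfill).trans ?_)
  rw [hLe, ← ENNReal.coe_mul, ENNReal.coe_le_coe]
  exact le_of_eq (by ring)

end DiskSquare

section QuasiIsometry

variable {X Y : Type*} [MetricSpace X] [MetricSpace Y]

theorem QuasiIsometric.exists_quasiInverse (h : QuasiIsometric X Y) :
    ∃ (ψ : X → Y) (φ : Y → X) (K c : ℝ≥0), (∀ x x', dist (ψ x) (ψ x') ≤ K * dist x x' + c) ∧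
      (∀ y y', dist (φ y) (φ y') ≤ K * dist y y' + c) ∧ ∀ x, dist (φ (ψ x)) x ≤ c := by
  obtain ⟨ψ, K, c, hK, hc, hψ, hdense⟩ := h
  choose φ hφ using hdense
  have hK0 : 0 < K := zero_lt_one.trans_le hK
  have hlow : ∀ x x', dist x x' ≤ K * (dist (ψ x) (ψ x') + c) := by
    intro x x'
    have h1 := (hψ x x').1
    have h2 : K⁻¹ * dist x x' ≤ dist (ψ x) (ψ x') + c := by linarith
    rwa [inv_mul_le_iff₀ hK0] at h2
  have hKc : c ≤ K * c := le_mul_of_one_le_left hc hK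
  refine ⟨ψ, φ, ⟨K, hK0.le⟩, ⟨3 * (K * c), by positivity⟩, ?_, ?_, ?_⟩
  · intro x x'
    change dist (ψ x) (ψ x') ≤ K * dist x x' + 3 * (K * c)
    linarith [(hψ x x').2]
  · intro y y'
    change dist (φ y) (φ y') ≤ K * dist y y' + 3 * (K * c)
    have h1 := hlow (φ y) (φ y')
    have h2 := dist_triangle4 (ψ (φ y)) y y' (ψ (φ y'))
    have h3 := hφ y
    have h4 := hφ y'
    rw [dist_comm] at h4
    have h5 : K * (dist (ψ (φ y)) (ψ (φ y')) + c) ≤ K * (dist y y' + 3 * c) :=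
      mul_le_mul_of_nonneg_left (by linarith) hK0.le
    linarith
  · intro x
    change dist (φ (ψ x)) x ≤ 3 * (K * c)
    have h1 := hlow (φ (ψ x)) x
    have h2 : K * (dist (ψ (φ (ψ x))) (ψ x) + c) ≤ K * (c + c) :=
      mul_le_mul_of_nonneg_left (by linarith [hφ (ψ x)]) hK0.le
    have h3 : 0 ≤ K * c := by positivity
    linarith

theorem HasLipschitzPaths.exists_lipschitzWith_interpolation (hX : HasLipschitzPaths X) {K : ℝ≥0}
    {u : ℤ → X} (hu : ∀ k, dist (u k) (u (k + 1)) < K) :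
    ∃ p : ℝ → X, LipschitzWith K p ∧ ∀ k : ℤ, p k = u k := by
  choose e he he0 he1 using fun k ↦ hX _ _ K (hu k)
  let p : ℝ → X := fun x ↦ e ⌊x⌋ (Int.fract x)
  have hp : ∀ (k : ℤ), ∀ x ∈ Icc (k : ℝ) (k + 1), p x = e k (x - k) := by
    intro k x hx
    rcases hx.2.lt_or_eq with hlt | heq
    · have : ⌊x⌋ = k := Int.floor_eq_iff.2 ⟨hx.1, hlt⟩
      simp only [p, Int.fract, this]
    · have hx' : x = ((k + 1 : ℤ) : ℝ) := by push_cast; exact heq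
      simp only [p, hx', Int.floor_intCast, Int.fract_intCast, he0]
      push_cast
      rw [add_sub_cancel_left, he1]
  refine ⟨p, lipschitzWith_of_lipschitzOnWith_Icc_int fun k ↦
    LipschitzOnWith.of_dist_le_mul fun x hx y hy ↦ ?_, fun k ↦ ?_⟩
  · rw [hp k x hx, hp k y hy]
    simpa using (he k).dist_le_mul (x - k) (y - k)
  · simp [p, he0]

/-- A map that is coarsely Lipschitz at the integer points of the boundary of `[0, N] × [0, N]` is
interpolated by a Lipschitz map on this boundary. -/
theorem HasLipschitzPaths.exists_lipschitzOnWith_boundary_interpolation (hX : HasLipschitzPaths X)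
    {K : ℝ≥0} {N : ℕ} (hN : 0 < N) {h : ℝ × ℝ → X}
    (hh : ∀ p ∈ squareBoundary N, ∀ q ∈ squareBoundary N, dist p q ≤ 1 → dist (h p) (h q) < K) :
    ∃ b : ℝ × ℝ → X, LipschitzOnWith (3 * K) b (squareBoundary N) ∧
      ∀ i j : ℤ, ((i : ℝ), (j : ℝ)) ∈ squareBoundary N → b (i, j) = h (i, j) := by
  have hN' : (0 : ℝ) < N := by exact_mod_cast hN
  have hside : ∀ ℓ : ℝ → ℝ × ℝ, LipschitzWith 1 ℓ →
      (∀ t, ¬ ((ℓ t).1 ∈ Ioo (0 : ℝ) N ∧ (ℓ t).2 ∈ Ioo (0 : ℝ) N)) →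
      ∃ p : ℝ → X, LipschitzWith K p ∧ ∀ k : ℤ, p k = h (clampSquare N (ℓ k)) := by
    intro ℓ hℓ hout
    refine hX.exists_lipschitzWith_interpolation (u := fun k ↦ h (clampSquare N (ℓ k))) fun k ↦ ?_
    refine hh _ (clampSquare_mem_squareBoundary hN'.le (hout _)) _
      (clampSquare_mem_squareBoundary hN'.le (hout _)) ?_
    have := ((lipschitzWith_clampSquare (N : ℝ)).comp hℓ).dist_le_mul k ((k + 1 : ℤ) : ℝ)
    simpa using this
  have hlh : ∀ y : ℝ, LipschitzWith 1 fun t : ℝ ↦ (t, y) := fun y ↦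
    LipschitzWith.of_dist_le_mul fun s t ↦ by simp [Prod.dist_eq]
  have hlv : ∀ x : ℝ, LipschitzWith 1 fun t : ℝ ↦ (x, t) := fun y ↦
    LipschitzWith.of_dist_le_mul fun s t ↦ by simp [Prod.dist_eq]
  obtain ⟨bot, hbot, hbot'⟩ := hside (fun t ↦ (t, 0)) (hlh 0) (by simp)
  obtain ⟨top, htop, htop'⟩ := hside (fun t ↦ (t, N)) (hlh N) (by simp)
  obtain ⟨left, hleft, hleft'⟩ := hside (fun t ↦ (0, t)) (hlv 0) (by simp)
  obtain ⟨right, hright, hright'⟩ := hside (fun t ↦ (N, t)) (hlv N) (by simp)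
  have h0 : ∀ (p : ℝ → X) (ℓ : ℝ → ℝ × ℝ), (∀ k : ℤ, p k = h (clampSquare N (ℓ k))) →
      p 0 = h (clampSquare N (ℓ 0)) := fun _ _ hp ↦ by simpa using hp 0
  have h1 : ∀ (p : ℝ → X) (ℓ : ℝ → ℝ × ℝ), (∀ k : ℤ, p k = h (clampSquare N (ℓ k))) →
      p N = h (clampSquare N (ℓ N)) := fun _ _ hp ↦ by simpa using hp N
  obtain ⟨b, hb, hbt⟩ := exists_lipschitzOnWith_squareBoundary hN' hbot.lipschitzOnWith
    htop.lipschitzOnWith hleft.lipschitzOnWith hright.lipschitzOnWith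
    ((h0 _ (fun t ↦ (t, 0)) hbot').trans (h0 _ _ hleft').symm)
    ((h1 _ (fun t ↦ (t, 0)) hbot').trans (h0 _ _ hright').symm)
    ((h0 _ (fun t ↦ (t, N)) htop').trans (h1 _ _ hleft').symm)
    ((h1 _ (fun t ↦ (t, N)) htop').trans (h1 _ _ hright').symm)
  refine ⟨b, hb, fun i j hij ↦ ?_⟩
  have hcl : clampSquare (N : ℝ) ((i : ℝ), (j : ℝ)) = ((i : ℝ), (j : ℝ)) :=
    clampSquare_of_mem hij.1 hij.2.1
  obtain ⟨hi, hj, h⟩ := hij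
  simp only at hi hj h
  rcases h with (h | h) | (h | h) <;> rw [h] at hcl ⊢
  · rw [(hbt i).1, hbot', hcl]
  · rw [(hbt i).2.1, htop', hcl]
  · rw [((hbt j).2.2 hj).1, hleft', hcl]
  · rw [((hbt j).2.2 hj).2, hright', hcl]

theorem QuasiIsometric.lipschitzOneConnected (hXY : QuasiIsometric X Y) (hX : HasLipschitzPaths X)
    (hY : HasLipschitzPaths Y) (hfill : LipschitzOneConnected Y) {ρ C₀ : ℝ≥0} (hρ : 0 < ρ)
    (hsmall : ∀ L ≤ ρ, SquareFills X L (C₀ * L)) (hall : ∀ R, ∃ M, SquareFills X R M) :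
    LipschitzOneConnected X := by
  obtain ⟨ψ, φ, K, c, hψ, hφ, hφψ⟩ := hXY.exists_quasiInverse
  obtain ⟨C, hC⟩ := hfill.exists_filling_square
  set K₁ : ℝ≥0 := K + c + 1 with hK₁
  set ρ' : ℝ≥0 := K * (C * (3 * K₁)) + c with hρ'
  set K₂ : ℝ≥0 := ρ' + c + 2 with hK₂
  obtain ⟨M, hM⟩ := hall (3 * K₂)
  refine lipschitzOneConnected_of_squareFills (C := max C₀ (2 * M * (1 + ρ⁻¹))) fun L ↦ ?_
  rcases le_or_gt L ρ with hL | hL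
  · exact (hsmall L hL).mono le_rfl (by gcongr; exact le_max_left _ _)
  intro g hg
  have hL0 : 0 < L := hρ.trans hL
  set N := ⌈L⌉₊ with hN
  have hNpos : 0 < N := Nat.ceil_pos.2 hL0
  have hNL : L ≤ N := Nat.le_ceil L
  have hN' : (N : ℝ≥0) ≤ (1 + ρ⁻¹) * L := by
    have h1 : (N : ℝ≥0) ≤ L + 1 := (Nat.ceil_lt_add_one L.2).le
    have h2 : 1 ≤ ρ⁻¹ * L := by rw [← inv_mul_cancel₀ hρ.ne']; gcongr
    rw [add_mul, one_mul]
    exact h1.trans (by gcongr)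
  have hNr : (0 : ℝ) < N := by exact_mod_cast hNpos
  have hNn : (0 : ℝ≥0) < N := by exact_mod_cast hNpos
  set a : ℝ≥0 := (N : ℝ≥0)⁻¹ with ha
  have ha' : (a : ℝ) = (N : ℝ)⁻¹ := by simp [ha]
  have ha0 : (0 : ℝ) < a := by rw [ha']; positivity
  have hmem : ∀ p ∈ squareBoundary N, (a : ℝ) • p ∈ squareBoundary 1 := by
    intro p hp
    have := smul_mem_squareBoundary ha0 hp
    rwa [ha', inv_mul_cancel₀ hNr.ne', ← ha'] at this
  set g' : ℝ × ℝ → X := fun p ↦ g ((a : ℝ) • p) with hg'def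
  have hg' : LipschitzOnWith 1 g' (squareBoundary N) := by
    refine (hg.comp (lipschitzWith_smul_prod a).lipschitzOnWith hmem).weaken ?_
    rw [ha, ← div_eq_mul_inv]
    exact div_le_one_of_le₀ hNL N.cast_nonneg
  obtain ⟨b, hb, hbh⟩ := hY.exists_lipschitzOnWith_boundary_interpolation (K := K₁) hNpos
    (h := fun p ↦ ψ (g' p)) (by
      intro p hp q hq hpq
      have h1 := hg'.dist_le_mul p hp q hq
      have h2 : dist (g' p) (g' q) ≤ 1 := h1.trans (by simpa using hpq)
      have h3 : (K : ℝ) * dist (g' p) (g' q) ≤ K := mul_le_of_le_one_right K.2 h2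
      have h4 := hψ (g' p) (g' q)
      rw [hK₁]
      push_cast
      linarith)
  have hK₁0 : 0 < K₁ := by positivity
  obtain ⟨f, hf, hfb⟩ := hC N hNn (3 * K₁) (by positivity) b (by simpa using hb)
  obtain ⟨F, hF, hFg⟩ := exists_filling_of_coarse_filling hX hM N (g := g') (w := fun p ↦ φ (f p))
    (τ := 1) (ρ := ρ') (σ := c) c.2
    (by rw [hK₂]; exact one_lt_two.trans_le (le_add_of_nonneg_left zero_le))
    (by rw [hK₂]; push_cast; linarith) hg'
    (by
      intro p q hpq
      refine (hφ _ _).trans ?_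
      have h1 := (hf.dist_le_mul p q).trans (mul_le_of_le_one_right (C * (3 * K₁)).2 hpq)
      rw [hρ', NNReal.coe_add, NNReal.coe_mul]
      gcongr)
    (by
      intro i j hij
      have h1 := hfb (by simpa using hij)
      rw [h1, hbh i j hij]
      exact hφψ _)
  refine ⟨fun p ↦ F ((N : ℝ) • p), ?_, fun p hp ↦ ?_⟩
  · have h1 := hF.comp (lipschitzWith_smul_prod N)
    have h2 : LipschitzWith (2 * M * N) fun p : ℝ × ℝ ↦ F ((N : ℝ) • p) := by
      simpa [Function.comp_def] using h1
    refine h2.weaken ?_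
    calc 2 * M * N ≤ 2 * M * ((1 + ρ⁻¹) * L) := by gcongr
      _ = 2 * M * (1 + ρ⁻¹) * L := by ring
      _ ≤ _ := by gcongr; exact le_max_right _ _
  · have h1 := smul_mem_squareBoundary hNr hp
    rw [mul_one] at h1
    simp only
    rw [hFg h1]
    simp only [hg'def]
    rw [ha', inv_smul_smul₀ hNr.ne']

end QuasiIsometry

theorem proposition3p6
    {n m : ℕ}
    {X : Type*} [MetricSpace X] [ChartedSpace (EuclideanSpace ℝ (Fin n)) X]
    [IsManifold (𝓡 n) ∞ X]
    [Bundle.RiemannianBundle (fun x : X ↦ TangentSpace (𝓡 n) x)]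
    [IsContMDiffRiemannianBundle (𝓡 n) ∞ (EuclideanSpace ℝ (Fin n))
      (fun x : X ↦ TangentSpace (𝓡 n) x)]
    [IsRiemannianManifold (𝓡 n) X]
    [CompleteSpace X] [SimplyConnectedSpace X]
    {Y : Type*} [MetricSpace Y] [ChartedSpace (EuclideanSpace ℝ (Fin m)) Y]
    [IsManifold (𝓡 m) ∞ Y]
    [Bundle.RiemannianBundle (fun y : Y ↦ TangentSpace (𝓡 m) y)]
    [IsContMDiffRiemannianBundle (𝓡 m) ∞ (EuclideanSpace ℝ (Fin m))
      (fun y : Y ↦ TangentSpace (𝓡 m) y)]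
    [IsRiemannianManifold (𝓡 m) Y]
    [CompleteSpace Y] [SimplyConnectedSpace Y]
    (hX : IsHomogeneousMetricSpace X) (hY : IsHomogeneousMetricSpace Y)
    (hXY : QuasiIsometric X Y) (hfill : LipschitzOneConnected Y) :
    LipschitzOneConnected X := by
  have : IsManifold (𝓡 n) 1 X := IsManifold.of_le (n := ∞) (by simp)
  have : IsContinuousRiemannianBundle (EuclideanSpace ℝ (Fin n))
      (fun x : X ↦ TangentSpace (𝓡 n) x) := by
    obtain ⟨⟨g, hg, hgi⟩⟩ := ‹IsContMDiffRiemannianBundle (𝓡 n) ∞ (EuclideanSpace ℝ (Fin n))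
      (fun x : X ↦ TangentSpace (𝓡 n) x)›
    exact ⟨g, hg.continuous, hgi⟩
  have hpX : HasLipschitzPaths X := IsRiemannianManifold.hasLipschitzPaths (𝓡 n) X
  have hpY : HasLipschitzPaths Y := IsRiemannianManifold.hasLipschitzPaths (𝓡 m) Y
  have : LocallyCompactSpace X := Manifold.locallyCompact_of_finiteDimensional (𝓡 n)
  have : ProperSpace X := hX.properSpace hpX
  obtain ⟨ρ, hρ, C, hC⟩ := hX.exists_squareFills_small (𝓡 n)
  refine hXY.lipschitzOneConnected hpX hpY hfill hρ hC fun R ↦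
    hX.exists_squareFills hpX (K := ρ / 3) (by positivity) (C := C * ρ) ?_ R
  rw [mul_div_cancel₀ _ three_ne_zero]
  exact hC ρ le_rfl
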